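/- **Setting.** Let $d\ge 1$, $\rho>0$, let $(\theta_j)_{j\ge1}$ be nonnegative real numbers, not all zero, and let $V:\mathbb R^d\to[0,\infty]$ be measurable, continuous at $0$, with $V(0)=0$, and such that for every $j\ge1$ $$\frac1{L^d}\sum_{x\in\mathbb Z^d}e^{-jV(x/L)}\ \longrightarrow\ \int_{\mathbb R^d}e^{-jV(x)}\,dx<\infty\qquad (L\to\infty).$$ A spatial partition of $n$ is a family $\lambda=(\lambda_x)_{x\in\mathbb Z^d}$ of integer partitions of total size $n$; let $r_{xj}$ be the number of parts equal to $j$ in $\lambda_x$, so that $\sum_{x,j}j\,r_{xj}=n$. Put $$\mathbb P_{L,n}(\lambda)=\frac1{Z_{L,n}}\prod_{x\in\mathbb Z^d}\prod_{j\ge1}\frac1{r_{xj}!}\Bigl(\frac{\theta_j}{j}e^{-jV(x/L)}\Bigr)^{r_{xj}},$$ where $Z_{L,n}$ is the sum over all spatial partitions of $n$ of the product on the right. Let $R_j=\sum_x r_{xj}$, $H_x=\sum_j j\,r_{xj}$, and $N_k=\#\{x\in\mathbb Z^d: H_x=k\}$. Let $$h_m=\sum_{\lambda\vdash m}\prod_{j\ge1}\frac1{r_j(\lambda)!}\Bigl(\frac{\theta_j}{j}\Bigr)^{r_j(\lambda)},\qquad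 \rho(z)=\sum_{j\ge1}\theta_jz^j\int_{\mathbb R^d}e^{-jV(x)}\,dx,$$ where the first sum is over the integer partitions $\lambda$ of $m$, with $r_j(\lambda)$ the number of parts of $\lambda$ equal to $j$. Let $z_c$ be the radius of convergence of the power series $\rho(z)$, assume $z_c\in(0,\infty]$, and let $\rho_c=\rho(z_c)\in(0,\infty]$. The thermodynamic limit is $n\to\infty$ with $L=L_n$ given by $\rho L^d=n$, along those $n$ for which $Z_{L,n}>0$. **Theorem (Typical sizes).** There are infinitely many $n$ with $Z_{L,n}>0$, and for all sufficiently large such $n$ one has $Z_{L,n}<\infty$, i.e. $\mathbb P_{L,n}$ is a probability measure. There is a unique $z_0(\rho)\in[0,\infty)$ such that $\rho(z_0(\rho))=\rho$ if $\rho<\rho_c$ and $z_0(\rho)=z_c$ if $\rho\ge\rho_c$. In the thermodynamic limit, for all $j\ge1$ and $k\ge0$, under $\mathbb P_{L,n}$, (a) $\displaystyle \frac{jR_j}{n}\to\frac1\rho\,\theta_j\,z_0(\rho)^j\int_{\mathbb R^d}e^{-jV(x)}\,dx$ in probability; (b) $\displaystyle \frac{k\,N_k}{n}\to\frac1\rho\int_{\mathbb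 R^d}\frac{k\,h_k\,z_0(\rho)^k\,e^{-kV(x)}}{\sum_{m\ge0}h_m\,z_0(\rho)^m\,e^{-mV(x)}}\,dx$ in probability, where the right-hand sides are finite, $kN_k$ is read as $0$ for $k=0$, and the integrand in (b) is read as $0$ where the denominator is infinite. -/

import Mathlib

open MeasureTheory Filter Topology
open scoped ENNReal NNReal Nat

/-- The point `x / L` of `ℝ^d`, for a site `x ∈ ℤ^d` and a length `L`. -/
noncomputable def scaledSite {d : ℕ} (L : ℝ) (x : Fin d → ℤ) : Fin d → ℝ :=
  fun i => (x i : ℝ) / L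

/-- The Boltzmann factor `e^{-j v}` for `v ∈ [0, ∞]` and `j ∈ ℕ`; it is `0` when `v = ∞` and
`j ≥ 1`, and it is `1` when `j = 0`. -/
noncomputable def boltzmann (j : ℕ) (v : ℝ≥0∞) : ℝ≥0∞ :=
  EReal.exp (-(((j : ℝ≥0∞) * v : ℝ≥0∞) : EReal))

/-- Spatial partitions of the integer `n`. A spatial partition is given by its occupation numbers:
`r x j` is the number of components equal to `j ≥ 1` of the integer partition at the site
`x ∈ ℤ^d`. The total size `∑_{x,j} j r_{xj}` is `n` (so all but finitely many `r_{xj}` vanish). -/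
def SpatialPartition (d n : ℕ) : Type :=
  {r : (Fin d → ℤ) →₀ (ℕ+ →₀ ℕ) // (r.sum fun _ s => s.sum fun j m => (j : ℕ) * m) = n}

namespace SpatialPartition

variable {d n : ℕ}

/-- Every set of spatial partitions is an event. -/
instance : MeasurableSpace (SpatialPartition d n) := ⊤

/-- `R_j = ∑_x r_{xj}`, the number of components of size `j`. -/
def R (lam : SpatialPartition d n) (j : ℕ+) : ℕ := lam.1.sum fun _ s => s j

/-- `H_x = ∑_j j r_{xj}`, the number of particles at the site `x`. -/
def H (lam : SpatialPartition d n) (x : Fin d → ℤ) : ℕ := (lam.1 x).sum fun j m => (j : ℕ) * m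

/-- `N_k`, the number of sites carrying exactly `k` particles. The set of these sites is finite for
`k ≥ 1`. For `k = 0` and `d ≥ 1` it is infinite and `Set.ncard` returns `0`; the number only
occurs in the product `k * N_k`, which vanishes for `k = 0`. -/
noncomputable def N (lam : SpatialPartition d n) (k : ℕ) : ℕ := {x | lam.H x = k}.ncard

/-- The weight `∏_x ∏_j (1 / r_{xj}!) ((θ_j / j) e^{-j V(x/L)})^{r_{xj}}`. -/
noncomputable def weight (θ : ℕ → ℝ≥0) (V : (Fin d → ℝ) → ℝ≥0∞) (L : ℝ)
    (lam : SpatialPartition d n) : ℝ≥0∞ :=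
  lam.1.prod fun x s => s.prod fun j m =>
    ((m ! : ℕ) : ℝ≥0∞)⁻¹ *
      ((θ j : ℝ≥0∞) / ((j : ℕ) : ℝ≥0∞) * boltzmann j (V (scaledSite L x))) ^ m

end SpatialPartition

/-- The partition function `Z_{L,n}`. -/
noncomputable def partitionFunction {d : ℕ} (θ : ℕ → ℝ≥0) (V : (Fin d → ℝ) → ℝ≥0∞) (L : ℝ)
    (n : ℕ) : ℝ≥0∞ :=
  ∑' lam : SpatialPartition d n, lam.weight θ V L

/-- The measure `P_{L,n}`, giving mass `weight / Z_{L,n}` to each spatial partition of `n`. It is a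
probability measure when `0 < Z_{L,n} < ∞`. -/
noncomputable def canonicalMeasure {d : ℕ} (θ : ℕ → ℝ≥0) (V : (Fin d → ℝ) → ℝ≥0∞) (L : ℝ)
    (n : ℕ) : Measure (SpatialPartition d n) :=
  Measure.sum fun lam => (lam.weight θ V L / partitionFunction θ V L n) • Measure.dirac lam

/-- `h_m`, a sum over the integer partitions of `m`; `r_j` is the multiplicity of the part `j`. -/
noncomputable def gibbsWeight (θ : ℕ → ℝ≥0) (m : ℕ) : ℝ≥0∞ :=
  ∑ p : Nat.Partition m, ∏ j ∈ p.parts.toFinset,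
    (((p.parts.count j) ! : ℕ) : ℝ≥0∞)⁻¹ *
      ((θ j : ℝ≥0∞) / (j : ℝ≥0∞)) ^ (p.parts.count j)

/-- `∫ e^{-j V(x)} dx`. -/
noncomputable def boltzmannIntegral {d : ℕ} (V : (Fin d → ℝ) → ℝ≥0∞) (j : ℕ) : ℝ≥0∞ :=
  ∫⁻ x, boltzmann j (V x)

/-- The assumption on the potential: `V : ℝ^d → [0, ∞]` is Lebesgue measurable, continuous at `0`
with `V(0) = 0`, and for every `j ≥ 1` the Riemann sums `L^{-d} ∑_x e^{-j V(x/L)}` converge to the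
(finite) integral `∫ e^{-jV}` as `L → ∞`. -/
structure AdmissiblePotential {d : ℕ} (V : (Fin d → ℝ) → ℝ≥0∞) : Prop where
  aemeasurable : AEMeasurable V volume
  continuousAt_zero : ContinuousAt V 0
  map_zero : V 0 = 0
  integral_ne_top : ∀ j : ℕ, 1 ≤ j → boltzmannIntegral V j ≠ ∞
  tendsto_riemannSum : ∀ j : ℕ, 1 ≤ j →
    Tendsto (fun L : ℝ =>
        (∑' x : Fin d → ℤ, boltzmann j (V (scaledSite L x))) / ENNReal.ofReal (L ^ d))
      atTop (𝓝 (boltzmannIntegral V j))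

/-- The density `ρ(z) = ∑_{j ≥ 1} θ_j z^j ∫ e^{-jV}`, as a function of the activity. -/
noncomputable def density {d : ℕ} (θ : ℕ → ℝ≥0) (V : (Fin d → ℝ) → ℝ≥0∞) (z : ℝ≥0∞) : ℝ≥0∞ :=
  ∑' j : ℕ+, (θ j : ℝ≥0∞) * z ^ (j : ℕ) * boltzmannIntegral V j

/-- The radius of convergence `z_c` of the power series `ρ(z)`: the supremum of the `z ∈ [0, ∞)`
where this series (whose coefficients are nonnegative) converges. -/
noncomputable def criticalActivity {d : ℕ} (θ : ℕ → ℝ≥0) (V : (Fin d → ℝ) → ℝ≥0∞) : ℝ≥0∞ :=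
  ⨆ (z : ℝ≥0) (_ : density θ V z ≠ ∞), (z : ℝ≥0∞)

/-- The transition density `ρ_c = ρ(z_c)`. -/
noncomputable def criticalDensity {d : ℕ} (θ : ℕ → ℝ≥0) (V : (Fin d → ℝ) → ℝ≥0∞) : ℝ≥0∞ :=
  density θ V (criticalActivity θ V)

/-- `z` is the activity `z_0(ρ)`: it solves `ρ(z) = ρ` if `ρ < ρ_c`, and it equals `z_c` if
`ρ ≥ ρ_c`. -/
def IsActivityAt {d : ℕ} (θ : ℕ → ℝ≥0) (V : (Fin d → ℝ) → ℝ≥0∞) (ρ : ℝ) (z : ℝ≥0) : Prop :=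
  (ENNReal.ofReal ρ < criticalDensity θ V → density θ V z = ENNReal.ofReal ρ) ∧
    (criticalDensity θ V ≤ ENNReal.ofReal ρ → (z : ℝ≥0∞) = criticalActivity θ V)

/-- The length `L` such that `ρ L^d = n`. -/
noncomputable def lengthAt (d : ℕ) (ρ : ℝ) (n : ℕ) : ℝ := ((n : ℝ) / ρ) ^ ((1 : ℝ) / (d : ℝ))

/-- The thermodynamic limit: `n → ∞` with `ρ L^d = n`, along those `n` with `Z_{L,n} ≠ 0`. -/
noncomputable def thermodynamicLimit {d : ℕ} (θ : ℕ → ℝ≥0) (V : (Fin d → ℝ) → ℝ≥0∞) (ρ : ℝ) :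
    Filter ℕ :=
  atTop ⊓ 𝓟 {n | partitionFunction θ V (lengthAt d ρ n) n ≠ 0}

/-- In the thermodynamic limit, the random variables `X n` on the spatial partitions of `n`,
distributed according to `P_{L,n}`, converge in probability to the (finite) constant `a`. -/
def TendstoInProbability {d : ℕ} (θ : ℕ → ℝ≥0) (V : (Fin d → ℝ) → ℝ≥0∞) (ρ : ℝ)
    (X : ∀ n : ℕ, SpatialPartition d n → ℝ) (a : ℝ≥0∞) : Prop :=
  a ≠ ∞ ∧ ∀ ε : ℝ, 0 < ε →
    Tendsto (fun n : ℕ =>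
        canonicalMeasure θ V (lengthAt d ρ n) n {lam | ε < |X n lam - a.toReal|})
      (thermodynamicLimit θ V ρ) (𝓝 0)

/-!
Write `u = e^{-V}`, `N = n / ρ = L^d`, `b_j = (θ_j / j) ∫ u^j` and `p(z) = ∑_j b_j z^j`. The proof
compares exponential rates in `N`: the partition function is
`Z_{L,n} = exp (N (p(z₀) - ρ log z₀) + o(N))`, and tilting the weights by an additive observable
multiplies the upper bound by an explicit exponential factor, so that the Chernoff bound gives
concentration with exponentially small tails.

*Upper bound.* For `z < z_c`, the sum of `z^n` times the tilted weights is at most the product over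
the sites `x` of the one-site sums (`pow_mul_tsum_tilt_le`). The one-site sum at the tilt `t` is at
most `exp (P(zu) + (e^t - 1) a(zu))` with `u = e^{-V(x/L)}` and `P(y) = ∑_j θ_j y^j / j`, where `a` is
`θ_j y^j / j` for the number of parts `j` and `h_k y^k / ∑_m h_m y^m` for the indicator of `k`
particles. The sum over `x` of the exponents is a Riemann sum of a function `u ψ(u)` with `ψ`
continuous on `[0, 1]`; by Weierstrass approximation the assumption on the powers `u^j` suffices for
its convergence (`tendsto_riemannSum`). This gives `eventually_moment_le`.

*Lower bound.* Only the partition function without tilt has to be bounded from below. Fix finitely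
many parts `j` with `θ_j ≠ 0` and densities `α_j ≥ 0` with `∑_j j α_j = ρ`, and keep in `Z_{L,n}` only
the configurations with about `α_j N` parts `j`. By the multinomial theorem and Stirling's formula,
they contribute `exp (N ∑_j (α_j log b_j - α_j log α_j + α_j) + o(N))`
(`eventually_le_partitionFunction`). For the total size to be exactly `n`, a bounded remainder has to
be placed at the site `0`, where `V = 0`; this is possible when `Z_{L,n} ≠ 0`, as a numerical semigroup
contains all large multiples of its gcd. The choice `α_j = b_j z₀^j` gives the rate
`p(z₀) - ρ log z₀`, up to the missing mass `ρ - ∑_j j α_j` of the truncation. If `ρ(z₀) = ρ`, this mass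
is small and is put on a fixed part. If `ρ(z₀) < ρ`, then `z₀ = z_c`, and it is put on one large part
`j` with `θ_j ∫ u^j` not much smaller than `z_c^{-j}` (`exists_large_part`): the excess condenses into
few parts and contributes only `-log z_c` per unit of mass.

*Conclusion.* At an activity `z < z₀` close to `z₀`, the rates of the two bounds differ by little, and
the observable has tilted rate `(e^t - 1) a_z` with `a_z → a_{z₀}`
(`tendstoInProbability_of_site_bound`). Working strictly below `z₀` avoids the singularity at `z_c`,
where the one-site sum may be infinite; there the limit of the integrals follows by dominated
convergence and Abel's theorem (`tendsto_lintegral_occupation`).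
-/

/-! ### Boltzmann factors and site weights -/

lemma boltzmann_eq_pow (j : ℕ) (v : ℝ≥0∞) : boltzmann j v = boltzmann 1 v ^ j := by
  unfold boltzmann
  induction v using ENNReal.recTopCoe with
  | top =>
    rcases Nat.eq_zero_or_pos j with rfl | hj
    · simp
    · have : ((j : ℝ≥0∞)) * ⊤ = ⊤ := ENNReal.mul_top (by exact_mod_cast hj.ne')
      simp [this, hj.ne']
  | coe v =>
    have h : ∀ i : ℕ, EReal.exp (-((((i : ℝ≥0∞) * (v : ℝ≥0∞)) : ℝ≥0∞) : EReal))
        = ENNReal.ofReal (Real.exp (-(i * v))) := by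
      intro i
      have : (-((((i : ℝ≥0∞) * (v : ℝ≥0∞)) : ℝ≥0∞) : EReal)) = ((-(i * v) : ℝ) : EReal) := by
        rw [EReal.coe_ennreal_mul, EReal.coe_neg, EReal.coe_mul]
        rfl
      rw [this, EReal.exp_coe]
    rw [h, h, ← ENNReal.ofReal_pow (Real.exp_nonneg _), ← Real.exp_nat_mul]
    congr 2
    push_cast
    ring

lemma boltzmann_le_one (j : ℕ) (v : ℝ≥0∞) : boltzmann j v ≤ 1 := by
  unfold boltzmann
  rw [← EReal.exp_zero]
  apply EReal.exp_monotone
  rw [EReal.neg_le, neg_zero]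
  exact EReal.coe_ennreal_nonneg _

lemma boltzmann_zero_right (j : ℕ) : boltzmann j 0 = 1 := by
  simp [boltzmann]

/-- The Boltzmann factor `e^{-v}` as a real number of `[0, 1]`. -/
noncomputable def boltzmannFactor (v : ℝ≥0∞) : ℝ := (boltzmann 1 v).toReal

lemma boltzmannFactor_mem_Icc (v : ℝ≥0∞) : boltzmannFactor v ∈ Set.Icc (0 : ℝ) 1 :=
  ⟨ENNReal.toReal_nonneg,
    ENNReal.toReal_mono ENNReal.one_ne_top (boltzmann_le_one 1 v)⟩

lemma ofReal_boltzmannFactor_pow (j : ℕ) (v : ℝ≥0∞) :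
    ENNReal.ofReal (boltzmannFactor v ^ j) = boltzmann j v := by
  rw [boltzmann_eq_pow, ENNReal.ofReal_pow (boltzmannFactor_mem_Icc v).1, boltzmannFactor,
    ENNReal.ofReal_toReal (ne_top_of_le_ne_top ENNReal.one_ne_top (boltzmann_le_one 1 v))]

lemma ofReal_boltzmannFactor (v : ℝ≥0∞) :
    ENNReal.ofReal (boltzmannFactor v) = boltzmann 1 v := by
  simpa using ofReal_boltzmannFactor_pow 1 v

/-- The size `∑_j j s_j` of the integer partition with multiplicities `s`. -/
def partSize (s : ℕ+ →₀ ℕ) : ℕ := s.sum fun j m => (j : ℕ) * m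

/-- The weight `∏_j (1 / s_j!) (θ_j y^j / j)^{s_j}` of the integer partition with multiplicities
`s`, at activity `y`. -/
noncomputable def siteWeight (θ : ℕ → ℝ≥0) (y : ℝ≥0∞) (s : ℕ+ →₀ ℕ) : ℝ≥0∞ :=
  s.prod fun j m => ((m ! : ℕ) : ℝ≥0∞)⁻¹ * ((θ j : ℝ≥0∞) / ((j : ℕ) : ℝ≥0∞) * y ^ (j : ℕ)) ^ m

lemma siteWeight_zero_right (θ : ℕ → ℝ≥0) (y : ℝ≥0∞) : siteWeight θ y 0 = 1 := by
  simp [siteWeight]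

lemma siteWeight_mul (θ : ℕ → ℝ≥0) (z y : ℝ≥0∞) (s : ℕ+ →₀ ℕ) :
    siteWeight θ (z * y) s = z ^ partSize s * siteWeight θ y s := by
  unfold siteWeight partSize
  rw [Finsupp.sum, ← Finset.prod_pow_eq_pow_sum, Finsupp.prod, Finsupp.prod,
    ← Finset.prod_mul_distrib]
  refine Finset.prod_congr rfl fun j _ => ?_
  rw [mul_pow, pow_mul]
  simp only [mul_pow]
  ring

lemma SpatialPartition.weight_eq {d n : ℕ} (θ : ℕ → ℝ≥0) (V : (Fin d → ℝ) → ℝ≥0∞) (L : ℝ)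
    (lam : SpatialPartition d n) :
    lam.weight θ V L =
      lam.1.prod fun x s => siteWeight θ (boltzmann 1 (V (scaledSite L x))) s := by
  unfold SpatialPartition.weight siteWeight
  simp only [← boltzmann_eq_pow]

/-- Summing products over all finitely supported configurations: the infinite product of the
one-site sums is an upper bound. -/
lemma tsum_finsupp_prod_le {X S : Type*} [Zero S] (W : X → S → ℝ≥0∞)
    (hW : ∀ x, W x 0 = 1) (K : ℝ≥0∞) (hK : ∀ A : Finset X, ∏ x ∈ A, ∑' s, W x s ≤ K) :
    ∑' r : X →₀ S, r.prod W ≤ K := by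
  classical
  rw [ENNReal.tsum_eq_iSup_sum]
  refine iSup_le fun T => ?_
  set A : Finset X := T.biUnion fun r => r.support with hA
  have hsub : ∀ r ∈ T, r.support ⊆ A := fun r hr => Finset.subset_biUnion_of_mem
    (fun r : X →₀ S => r.support) hr
  refine le_trans ?_ (hK A)
  calc ∑ r ∈ T, r.prod W
      = ∑ r ∈ T, ∏ x ∈ A.attach, W x ((fun x (_ : x ∈ A) => r x) x.1 x.2) := by
        refine Finset.sum_congr rfl fun r hr => ?_
        rw [Finsupp.prod_of_support_subset r (hsub r hr) _ (fun x _ => hW x)]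
        exact (Finset.prod_attach A fun x => W x (r x)).symm
    _ = ∑ p ∈ T.image (fun (r : X →₀ S) x (_ : x ∈ A) => r x),
          ∏ x ∈ A.attach, W x (p x.1 x.2) := by
        rw [Finset.sum_image]
        intro r hr r' hr' h
        ext x
        by_cases hx : x ∈ A
        · exact congrFun (congrFun h x) hx
        · have h1 : r x = 0 := by
            by_contra h0
            exact hx (hsub r hr (Finsupp.mem_support_iff.2 h0))
          have h2 : r' x = 0 := by
            by_contra h0
            exact hx (hsub r' hr' (Finsupp.mem_support_iff.2 h0))
          rw [h1, h2]
    _ ≤ ∑ p ∈ A.pi (fun x => T.image fun r => r x), ∏ x ∈ A.attach, W x (p x.1 x.2) := by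
        refine Finset.sum_le_sum_of_subset fun p hp => ?_
        obtain ⟨r, hr, rfl⟩ := Finset.mem_image.1 hp
        exact Finset.mem_pi.2 fun x _ => Finset.mem_image_of_mem (fun r : X →₀ S => r x) hr
    _ = ∏ x ∈ A, ∑ s ∈ T.image (fun r => r x), W x s := (Finset.prod_sum _ _ _).symm
    _ ≤ ∏ x ∈ A, ∑' s, W x s := Finset.prod_le_prod' fun x _ => ENNReal.sum_le_tsum _

lemma tsum_inv_factorial_mul_pow (q : ℝ) (hq : 0 ≤ q) :
    ∑' m : ℕ, ((m ! : ℕ) : ℝ≥0∞)⁻¹ * ENNReal.ofReal q ^ m = ENNReal.ofReal (Real.exp q) := by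
  have h := NormedSpace.exp_series_hasSum_exp' (𝕂 := ℝ) q
  rw [← Real.exp_eq_exp_ℝ] at h
  rw [← h.tsum_eq, ENNReal.ofReal_tsum_of_nonneg (fun m => by positivity) h.summable]
  refine tsum_congr fun m => ?_
  rw [smul_eq_mul, ENNReal.ofReal_mul (by positivity), ENNReal.ofReal_pow hq,
    ENNReal.ofReal_inv_of_pos (by positivity), ENNReal.ofReal_natCast]

/-- The grand-canonical bound: the total weight of all multiplicity vectors is at most
`exp (∑_j q_j)`. -/
lemma tsum_prod_inv_factorial_le (q : ℕ+ → ℝ) (hq : ∀ j, 0 ≤ q j) (hs : Summable q) :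
    ∑' s : ℕ+ →₀ ℕ, s.prod (fun j m => ((m ! : ℕ) : ℝ≥0∞)⁻¹ * ENNReal.ofReal (q j) ^ m) ≤
      ENNReal.ofReal (Real.exp (∑' j, q j)) := by
  refine tsum_finsupp_prod_le _ (by simp) _ fun A => ?_
  rw [Finset.prod_congr rfl fun j _ => tsum_inv_factorial_mul_pow (q j) (hq j),
    ← ENNReal.ofReal_prod_of_nonneg fun j _ => Real.exp_nonneg _, ← Real.exp_sum]
  exact ENNReal.ofReal_le_ofReal (Real.exp_le_exp.2 (hs.sum_le_tsum A fun j _ => hq j))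

lemma partSize_sum {d n : ℕ} (lam : SpatialPartition d n) :
    (lam.1.sum fun _ s => partSize s) = n := lam.2

lemma prod_tilt_mul_siteWeight {X : Type*} (θ : ℕ → ℝ≥0) (z : ℝ≥0∞) (τ : (ℕ+ →₀ ℕ) → ℝ≥0∞)
    (b : X → ℝ≥0∞) (r : X →₀ (ℕ+ →₀ ℕ)) :
    z ^ (r.sum fun _ s => partSize s) *
        ((r.prod fun _ s => τ s) * r.prod fun x s => siteWeight θ (b x) s) =
      r.prod fun x s => τ s * siteWeight θ (z * b x) s := by
  rw [Finsupp.sum, ← Finset.prod_pow_eq_pow_sum, Finsupp.prod, Finsupp.prod, Finsupp.prod,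
    ← Finset.prod_mul_distrib, ← Finset.prod_mul_distrib]
  refine Finset.prod_congr rfl fun x _ => ?_
  rw [siteWeight_mul]
  ring

/-- The exponential moment bound. The function `τ` is the contribution of one site to the
exponential of the observable. -/
lemma pow_mul_tsum_tilt_le {d n : ℕ} (θ : ℕ → ℝ≥0) (V : (Fin d → ℝ) → ℝ≥0∞) (L : ℝ) (z K : ℝ≥0∞)
    (τ : (ℕ+ →₀ ℕ) → ℝ≥0∞) (hτ : τ 0 = 1)
    (hK : ∀ A : Finset (Fin d → ℤ),
      ∏ x ∈ A, ∑' s, τ s * siteWeight θ (z * boltzmann 1 (V (scaledSite L x))) s ≤ K) :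
    z ^ n * ∑' lam : SpatialPartition d n, (lam.1.prod fun _ s => τ s) * lam.weight θ V L ≤ K := by
  refine le_trans ?_ (tsum_finsupp_prod_le
    (fun x s => τ s * siteWeight θ (z * boltzmann 1 (V (scaledSite L x))) s)
    (fun x => by simp [hτ, siteWeight_zero_right]) K hK)
  rw [← ENNReal.tsum_mul_left]
  refine le_trans (le_of_eq (tsum_congr fun lam => ?_))
    (ENNReal.tsum_comp_le_tsum_of_injective (f := (Subtype.val : SpatialPartition d n → _))
      Subtype.val_injective _)
  rw [SpatialPartition.weight_eq]
  have h := prod_tilt_mul_siteWeight θ z τ (fun x => boltzmann 1 (V (scaledSite L x))) lam.1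
  rw [partSize_sum lam] at h
  exact h

/-! ### Grouping the partitions at a site by size -/

/-- The multiplicities of the parts of an integer partition. -/
noncomputable def partMultiplicities {m : ℕ} (p : Nat.Partition m) : ℕ+ →₀ ℕ :=
  Finsupp.comapDomain (fun j : ℕ+ => (j : ℕ)) (Multiset.toFinsupp p.parts)
    PNat.coe_injective.injOn

lemma partMultiplicities_apply {m : ℕ} (p : Nat.Partition m) (j : ℕ+) :
    partMultiplicities p j = p.parts.count (j : ℕ) := rfl

lemma prod_partMultiplicities {m : ℕ} (p : Nat.Partition m) {M : Type*} [CommMonoid M]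
    (f : ℕ → ℕ → M) :
    ((partMultiplicities p).prod fun j r => f j r) =
      ∏ j ∈ p.parts.toFinset, f j (p.parts.count j) := by
  classical
  rw [Finsupp.prod]
  refine Finset.prod_bij (fun j _ => (j : ℕ)) ?_ ?_ ?_ ?_
  · intro j hj
    rw [Finsupp.mem_support_iff, partMultiplicities_apply] at hj
    exact Multiset.mem_toFinset.2 (Multiset.count_ne_zero.1 hj)
  · intro j _ j' _ h
    exact PNat.coe_injective h
  · intro j hj
    have hj' := Multiset.mem_toFinset.1 hj
    exact ⟨⟨j, p.parts_pos hj'⟩,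
      Finsupp.mem_support_iff.2 (Multiset.count_ne_zero.2 hj'), rfl⟩
  · intro j _
    rfl

lemma partSize_partMultiplicities {m : ℕ} (p : Nat.Partition m) :
    partSize (partMultiplicities p) = m := by
  have h := prod_partMultiplicities p (M := Multiplicative ℕ)
    (fun j r => Multiplicative.ofAdd (j * r))
  have h2 : partSize (partMultiplicities p)
      = ∑ j ∈ p.parts.toFinset, j * p.parts.count j := h
  rw [h2]
  conv_rhs => rw [← p.parts_sum, Finset.sum_multiset_count]
  exact Finset.sum_congr rfl fun j _ => by rw [smul_eq_mul, mul_comm]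

lemma partMultiplicities_bijective (m : ℕ) :
    Function.Bijective (fun p : Nat.Partition m =>
      (⟨partMultiplicities p, partSize_partMultiplicities p⟩ : {s // partSize s = m})) := by
  classical
  constructor
  · intro p p' h
    have h1 : partMultiplicities p = partMultiplicities p' := congrArg Subtype.val h
    refine Nat.Partition.ext (Multiset.ext.2 fun j => ?_)
    rcases Nat.eq_zero_or_pos j with rfl | hj
    · rw [Multiset.count_eq_zero_of_notMem fun h0 => (p.parts_pos h0).ne rfl,
        Multiset.count_eq_zero_of_notMem fun h0 => (p'.parts_pos h0).ne rfl]
    · exact DFunLike.congr_fun h1 ⟨j, hj⟩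
  · rintro ⟨s, hs⟩
    have hsum : ((Finsupp.toMultiset s).map (fun j : ℕ+ => (j : ℕ))).sum = m := by
      rw [← hs, partSize, Finsupp.toMultiset_apply, Finsupp.sum, Finsupp.sum,
        ← Multiset.coe_mapAddMonoidHom, map_sum, ← Multiset.coe_sumAddMonoidHom, map_sum]
      refine Finset.sum_congr rfl fun j _ => ?_
      rw [Multiset.coe_mapAddMonoidHom, Multiset.coe_sumAddMonoidHom, Multiset.map_nsmul,
        Multiset.sum_nsmul, Multiset.map_singleton, Multiset.sum_singleton, smul_eq_mul, mul_comm]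
    refine ⟨⟨(Finsupp.toMultiset s).map (fun j : ℕ+ => (j : ℕ)), ?_, hsum⟩, ?_⟩
    · intro i hi
      obtain ⟨j, _, rfl⟩ := Multiset.mem_map.1 hi
      exact j.pos
    · refine Subtype.ext (Finsupp.ext fun j => ?_)
      rw [partMultiplicities_apply]
      simp only
      rw [Multiset.count_map_eq_count' _ _ PNat.coe_injective, Finsupp.count_toMultiset]

lemma tsum_siteWeight_partSize_eq (θ : ℕ → ℝ≥0) (m : ℕ) :
    ∑' s : {s // partSize s = m}, siteWeight θ 1 s.1 = gibbsWeight θ m := by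
  rw [← Equiv.tsum_eq (Equiv.ofBijective _ (partMultiplicities_bijective m)), tsum_fintype,
    gibbsWeight]
  refine Finset.sum_congr rfl fun p _ => ?_
  simp only [Equiv.ofBijective_apply, siteWeight, one_pow, mul_one]
  exact prod_partMultiplicities p fun j r =>
    ((r ! : ℕ) : ℝ≥0∞)⁻¹ * ((θ j : ℝ≥0∞) / (j : ℝ≥0∞)) ^ r

/-- The generating function of the numbers `h_m`, with a tilt depending on the size only. -/
lemma tsum_tilt_mul_siteWeight (θ : ℕ → ℝ≥0) (y : ℝ≥0∞) (f : ℕ → ℝ≥0∞) :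
    ∑' s : ℕ+ →₀ ℕ, f (partSize s) * siteWeight θ y s =
      ∑' m : ℕ, f m * (gibbsWeight θ m * y ^ m) := by
  rw [← (Equiv.sigmaFiberEquiv partSize).tsum_eq, ENNReal.tsum_sigma']
  refine tsum_congr fun m => ?_
  rw [← tsum_siteWeight_partSize_eq, ENNReal.tsum_mul_right.symm, ← ENNReal.tsum_mul_left]
  refine tsum_congr fun s => ?_
  have h := siteWeight_mul θ y 1 s.1
  rw [mul_one] at h
  simp only [Equiv.sigmaFiberEquiv, Equiv.coe_fn_mk]
  rw [h, s.2]
  ring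

/-! ### A lower bound on the partition function -/

lemma sum_pow_mul_inv_factorial {X : Type*} [DecidableEq X] (A : Finset X) (c : X → ℝ≥0∞) (r : ℕ) :
    (∑ x ∈ A, c x) ^ r * ((r ! : ℕ) : ℝ≥0∞)⁻¹ =
      ∑ k ∈ A.piAntidiag r, ∏ x ∈ A, (((k x)! : ℕ) : ℝ≥0∞)⁻¹ * c x ^ k x := by
  rw [Finset.sum_pow_eq_sum_piAntidiag, Finset.sum_mul]
  refine Finset.sum_congr rfl fun k hk => ?_
  have hsum : ∑ x ∈ A, k x = r := (Finset.mem_piAntidiag.1 hk).1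
  have hspec := Nat.multinomial_spec A k
  rw [hsum] at hspec
  have hne : ((∏ x ∈ A, (k x)! : ℕ) : ℝ≥0∞) ≠ 0 := by
    exact_mod_cast (Finset.prod_pos fun x _ => Nat.factorial_pos (k x)).ne'
  have hinv : (((∏ x ∈ A, (k x)! : ℕ) : ℝ≥0∞))⁻¹ = ∏ x ∈ A, (((k x)! : ℕ) : ℝ≥0∞)⁻¹ := by
    rw [Nat.cast_prod]
    exact ENNReal.prod_inv_distrib fun x _ y _ _ => Or.inr (ENNReal.natCast_ne_top _)
  have hmul : (Nat.multinomial A k : ℝ≥0∞) * ((r ! : ℕ) : ℝ≥0∞)⁻¹ =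
      ∏ x ∈ A, (((k x)! : ℕ) : ℝ≥0∞)⁻¹ := by
    rw [← hinv, ← hspec, Nat.cast_mul,
      ENNReal.mul_inv (Or.inl hne) (Or.inl (ENNReal.natCast_ne_top _)), mul_comm, mul_assoc,
      ENNReal.inv_mul_cancel, mul_one]
    · have : Nat.multinomial A k ≠ 0 := fun h0 => by
        rw [h0, mul_zero] at hspec
        exact (Nat.factorial_pos r).ne hspec
      exact_mod_cast this
    · exact ENNReal.natCast_ne_top _
  rw [Finset.prod_mul_distrib, ← hmul]
  ring

/-- The configuration carrying the multiplicities `s₀` at the site `o` and the multiplicities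
`q j x` of the parts `j ∈ F` at the sites `x ∈ A`. -/
noncomputable def blockConfig {X : Type*} (o : X) (s₀ : ℕ+ →₀ ℕ) (A : Finset X) (F : Finset ℕ+)
    (q : ℕ+ → X → ℕ) : X →₀ (ℕ+ →₀ ℕ) :=
  Finsupp.single o s₀ + Finsupp.indicator A fun x _ => Finsupp.indicator F fun j _ => q j x

lemma blockConfig_prod {X : Type*} {o : X} (s₀ : ℕ+ →₀ ℕ) {A : Finset X} (ho : o ∉ A)
    (F : Finset ℕ+) (q : ℕ+ → X → ℕ) {M : Type*} [CommMonoid M] (f : X → ℕ+ → ℕ → M)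
    (hf : ∀ x j, f x j 0 = 1) :
    ((blockConfig o s₀ A F q).prod fun x s => s.prod (f x)) =
      s₀.prod (f o) * ∏ x ∈ A, ∏ j ∈ F, f x j (q j x) := by
  classical
  rw [blockConfig, Finsupp.prod_add_index_of_disjoint, Finsupp.prod_single_index,
    Finsupp.prod_indicator_index]
  · congr 1
    refine Finset.prod_congr rfl fun x _ => ?_
    rw [Finsupp.prod_indicator_index _ fun j _ => hf x j]
  · simp
  · simp
  · refine Finset.disjoint_of_subset_left Finsupp.support_single_subset
      (Finset.disjoint_of_subset_right (Finsupp.support_indicator_subset _ _) ?_)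
    simpa using ho

lemma blockConfig_apply {X : Type*} {o : X} (s₀ : ℕ+ →₀ ℕ) {A : Finset X} (ho : o ∉ A)
    {F : Finset ℕ+} (q : ℕ+ → X → ℕ) {x : X} (hx : x ∈ A) {j : ℕ+} (hj : j ∈ F) :
    blockConfig o s₀ A F q x j = q j x := by
  classical
  have hne : x ≠ o := fun h => ho (h ▸ hx)
  simp [blockConfig, hne.symm, hx, hj]

/-- Prescribing the total multiplicities `r_j` of finitely many parts `j` on a finite set of sites,
and the partition at the remaining site `0`, bounds the partition function from below. -/
lemma le_partitionFunction {d n : ℕ} (θ : ℕ → ℝ≥0) (V : (Fin d → ℝ) → ℝ≥0∞) (hV0 : V 0 = 0) (L : ℝ)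
    (s₀ : ℕ+ →₀ ℕ) (A : Finset (Fin d → ℤ)) (h0 : (0 : Fin d → ℤ) ∉ A) (F : Finset ℕ+)
    (r : ℕ+ → ℕ) (hn : partSize s₀ + ∑ j ∈ F, (j : ℕ) * r j = n) :
    siteWeight θ 1 s₀ * ∏ j ∈ F,
        ((∑ x ∈ A, (θ j : ℝ≥0∞) / ((j : ℕ) : ℝ≥0∞) * boltzmann j (V (scaledSite L x))) ^ r j *
          (((r j)! : ℕ) : ℝ≥0∞)⁻¹) ≤ partitionFunction θ V L n := by
  classical
  set w : (Fin d → ℤ) → ℕ+ → ℕ → ℝ≥0∞ := fun x j m => ((m ! : ℕ) : ℝ≥0∞)⁻¹ *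
    ((θ j : ℝ≥0∞) / ((j : ℕ) : ℝ≥0∞) * boltzmann j (V (scaledSite L x))) ^ m with hw
  set Q := F.pi fun j => A.piAntidiag (r j) with hQ
  let ext : (∀ j ∈ F, (Fin d → ℤ) → ℕ) → ℕ+ → (Fin d → ℤ) → ℕ :=
    fun p j x => if h : j ∈ F then p j h x else 0
  have hext : ∀ p (j : ℕ+) (hj : j ∈ F) x, ext p j x = p j hj x := fun p j hj x => by
    simp [ext, hj]
  have hsize : ∀ p ∈ Q, ((blockConfig 0 s₀ A F (ext p)).sum fun _ s => s.sum fun j m =>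
      (j : ℕ) * m) = n := by
    intro p hp
    have h := blockConfig_prod (M := Multiplicative ℕ) s₀ h0 F (ext p)
      (fun _ j m => Multiplicative.ofAdd ((j : ℕ) * m)) (fun _ _ => by simp)
    have h' : ((blockConfig 0 s₀ A F (ext p)).sum fun _ s => s.sum fun j m => (j : ℕ) * m) =
      partSize s₀ + ∑ x ∈ A, ∑ j ∈ F, (j : ℕ) * ext p j x := h
    rw [h', ← hn, Finset.sum_comm]
    congr 1
    refine Finset.sum_congr rfl fun j hj => ?_
    rw [← Finset.mul_sum, ← (Finset.mem_piAntidiag.1 (Finset.mem_pi.1 hp j hj)).1]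
    exact congrArg _ (Finset.sum_congr rfl fun x _ => hext p j hj x)
  let cfg : {p // p ∈ Q} → SpatialPartition d n := fun p =>
    ⟨blockConfig 0 s₀ A F (ext p.1), hsize p.1 p.2⟩
  have hcfg : Function.Injective cfg := by
    intro p p' h
    have h1 : blockConfig 0 s₀ A F (ext p.1) = blockConfig 0 s₀ A F (ext p'.1) :=
      congrArg Subtype.val h
    refine Subtype.ext (funext fun j => funext fun hj => funext fun x => ?_)
    by_cases hx : x ∈ A
    · rw [← hext p.1 j hj, ← hext p'.1 j hj, ← blockConfig_apply s₀ h0 (ext p.1) hx hj, h1,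
        blockConfig_apply s₀ h0 (ext p'.1) hx hj]
    · have h2 := (Finset.mem_piAntidiag.1 (Finset.mem_pi.1 p.2 j hj)).2 x
      have h3 := (Finset.mem_piAntidiag.1 (Finset.mem_pi.1 p'.2 j hj)).2 x
      rw [not_imp_comm.1 h2 hx, not_imp_comm.1 h3 hx]
  have hweight : ∀ p, (cfg p).weight θ V L =
      siteWeight θ 1 s₀ * ∏ x ∈ A, ∏ j ∈ F, w x j (ext p.1 j x) := by
    intro p
    have h := blockConfig_prod s₀ h0 F (ext p.1) w (fun _ _ => by simp [hw])
    refine h.trans ?_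
    congr 1
    have hs : scaledSite L (0 : Fin d → ℤ) = 0 := by
      funext i
      simp [scaledSite]
    simp [hw, siteWeight, hs, hV0, boltzmann_zero_right]
  calc _ = siteWeight θ 1 s₀ * ∏ j ∈ F, ∑ k ∈ A.piAntidiag (r j), ∏ x ∈ A, w x j (k x) := by
        simp only [sum_pow_mul_inv_factorial, hw]
    _ = siteWeight θ 1 s₀ * ∑ p ∈ Q, ∏ j ∈ F.attach, ∏ x ∈ A, w x j.1 (p j.1 j.2 x) := by
        rw [Finset.prod_sum]
    _ = ∑ p ∈ Q, siteWeight θ 1 s₀ * ∏ x ∈ A, ∏ j ∈ F, w x j (ext p j x) := by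
        rw [Finset.mul_sum]
        refine Finset.sum_congr rfl fun p _ => ?_
        rw [Finset.prod_comm]
        congr 1
        refine Finset.prod_congr rfl fun x _ => ?_
        rw [← Finset.prod_attach F]
        exact Finset.prod_congr rfl fun j _ => by rw [hext p j.1 j.2 x]
    _ = ∑' p : {p // p ∈ Q}, (cfg p).weight θ V L := by
        rw [tsum_fintype, ← Finset.sum_coe_sort Q]
        exact Finset.sum_congr rfl fun p _ => (hweight p).symm
    _ ≤ partitionFunction θ V L n := ENNReal.tsum_comp_le_tsum_of_injective hcfg _

/-- If `Z_{L,n} > 0`, then `n` is a sum of integers `j` with `θ_j > 0`. -/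
lemma mem_closure_of_partitionFunction_ne_zero {d n : ℕ} (θ : ℕ → ℝ≥0)
    (V : (Fin d → ℝ) → ℝ≥0∞) (L : ℝ) (hZ : partitionFunction θ V L n ≠ 0) :
    n ∈ AddSubmonoid.closure {j : ℕ | 1 ≤ j ∧ θ j ≠ 0} := by
  obtain ⟨lam, hlam⟩ : ∃ lam : SpatialPartition d n, lam.weight θ V L ≠ 0 := by
    by_contra! h
    exact hZ (ENNReal.tsum_eq_zero.2 h)
  have h2 := lam.2
  rw [← h2]
  refine AddSubmonoid.sum_mem _ fun x hx => AddSubmonoid.sum_mem _ fun j hj => ?_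
  change (j : ℕ) * lam.1 x j ∈ _
  rw [mul_comm, ← smul_eq_mul]
  have hmem : θ j ≠ 0 → (j : ℕ) ∈ {j : ℕ | 1 ≤ j ∧ θ j ≠ 0} := fun h => ⟨j.pos, h⟩
  refine AddSubmonoid.nsmul_mem _ (AddSubmonoid.subset_closure (hmem fun h0 => hlam ?_)) _
  refine Finset.prod_eq_zero hx (Finset.prod_eq_zero hj ?_)
  have := Finsupp.mem_support_iff.1 hj
  simp [h0, this]

/-- Every element of the numerical semigroup generated by the support of `θ` is the size of a
partition of positive weight. -/
lemma exists_siteWeight_ne_zero (θ : ℕ → ℝ≥0) {m : ℕ}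
    (hm : m ∈ AddSubmonoid.closure {j : ℕ | 1 ≤ j ∧ θ j ≠ 0}) :
    ∃ s : ℕ+ →₀ ℕ, partSize s = m ∧ ∀ j ∈ s.support, θ j ≠ 0 := by
  classical
  induction hm using AddSubmonoid.closure_induction with
  | mem j hj =>
    obtain ⟨j, rfl⟩ : ∃ i : ℕ+, (i : ℕ) = j := ⟨⟨j, hj.1⟩, rfl⟩
    refine ⟨Finsupp.single j 1, ?_, fun i hi => ?_⟩
    · simp [partSize]
    · rw [Finset.mem_singleton.1 (Finsupp.support_single_subset hi)]
      exact hj.2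
  | zero => exact ⟨0, by simp [partSize], by simp⟩
  | add x y _ _ hx hy =>
    obtain ⟨s, hs, hs'⟩ := hx
    obtain ⟨t, ht, ht'⟩ := hy
    refine ⟨s + t, ?_, fun i hi => ?_⟩
    · rw [← hs, ← ht, partSize, Finsupp.sum_add_index'] <;> simp [partSize, mul_add]
    · rcases Finset.mem_union.1 (Finsupp.support_add hi) with h | h
      exacts [hs' i h, ht' i h]

lemma siteWeight_ne_zero {θ : ℕ → ℝ≥0} {s : ℕ+ →₀ ℕ} (hs : ∀ j ∈ s.support, θ j ≠ 0) :
    siteWeight θ 1 s ≠ 0 := by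
  refine Finset.prod_ne_zero_iff.2 fun j hj => mul_ne_zero ?_ (pow_ne_zero _ ?_)
  · exact ENNReal.inv_ne_zero.2 (ENNReal.natCast_ne_top _)
  · simpa using hs j hj

lemma partitionFunction_ne_zero {d n : ℕ} {θ : ℕ → ℝ≥0} {V : (Fin d → ℝ) → ℝ≥0∞} (hV0 : V 0 = 0)
    (L : ℝ) (hn : n ∈ AddSubmonoid.closure {j : ℕ | 1 ≤ j ∧ θ j ≠ 0}) :
    partitionFunction θ V L n ≠ 0 := by
  obtain ⟨s, hs, hs'⟩ := exists_siteWeight_ne_zero θ hn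
  have h := le_partitionFunction (n := n) θ V hV0 L s ∅ (by simp) ∅ 0 (by simpa using hs)
  intro h0
  rw [h0] at h
  simp only [Finset.prod_empty, mul_one, nonpos_iff_eq_zero] at h
  exact siteWeight_ne_zero hs' h

/-! ### Riemann sums -/

lemma lengthAt_pow {d : ℕ} (hd : 1 ≤ d) {ρ : ℝ} (hρ : 0 < ρ) (n : ℕ) :
    lengthAt d ρ n ^ d = n / ρ := by
  have hd' : (d : ℝ) ≠ 0 := by exact_mod_cast (by omega : d ≠ 0)
  rw [lengthAt, ← Real.rpow_natCast, ← Real.rpow_mul (by positivity), one_div,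
    inv_mul_cancel₀ hd', Real.rpow_one]

lemma tendsto_natCast_div_atTop {ρ : ℝ} (hρ : 0 < ρ) :
    Tendsto (fun n : ℕ => (n : ℝ) / ρ) atTop atTop :=
  tendsto_natCast_atTop_atTop.atTop_div_const hρ

lemma tendsto_lengthAt {d : ℕ} (hd : 1 ≤ d) {ρ : ℝ} (hρ : 0 < ρ) :
    Tendsto (lengthAt d ρ) atTop atTop :=
  (tendsto_rpow_atTop (by positivity)).comp (tendsto_natCast_div_atTop hρ)

/-- The real Boltzmann factor `e^{-V(x/L)}` of the site `x`, at the length `L` with `ρ L^d = n`. -/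
noncomputable def siteFactor {d : ℕ} (V : (Fin d → ℝ) → ℝ≥0∞) (ρ : ℝ) (n : ℕ)
    (x : Fin d → ℤ) : ℝ :=
  boltzmannFactor (V (scaledSite (lengthAt d ρ n) x))

lemma siteFactor_mem_Icc {d : ℕ} (V : (Fin d → ℝ) → ℝ≥0∞) (ρ : ℝ) (n : ℕ) (x : Fin d → ℤ) :
    siteFactor V ρ n x ∈ Set.Icc (0 : ℝ) 1 := boltzmannFactor_mem_Icc _

section Riemann

variable {d : ℕ} {V : (Fin d → ℝ) → ℝ≥0∞} {ρ : ℝ}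

lemma tsum_ofReal_siteFactor_pow (n j : ℕ) :
    ∑' x, ENNReal.ofReal (siteFactor V ρ n x ^ j) =
      ∑' x, boltzmann j (V (scaledSite (lengthAt d ρ n) x)) :=
  tsum_congr fun _ => ofReal_boltzmannFactor_pow _ _

lemma tendsto_riemannSum_ennreal (hd : 1 ≤ d) (hρ : 0 < ρ) (hV : AdmissiblePotential V) {j : ℕ}
    (hj : 1 ≤ j) :
    Tendsto (fun n : ℕ => (∑' x, ENNReal.ofReal (siteFactor V ρ n x ^ j)) /
      ENNReal.ofReal (n / ρ)) atTop (𝓝 (boltzmannIntegral V j)) := by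
  have h := (hV.tendsto_riemannSum j hj).comp (tendsto_lengthAt hd hρ)
  refine h.congr fun n => ?_
  rw [tsum_ofReal_siteFactor_pow, Function.comp_apply, lengthAt_pow hd hρ]

lemma eventually_summable_siteFactor (hd : 1 ≤ d) (hρ : 0 < ρ) (hV : AdmissiblePotential V) :
    ∀ᶠ n : ℕ in atTop, Summable (siteFactor V ρ n) := by
  have h := tendsto_riemannSum_ennreal hd hρ hV le_rfl
  filter_upwards [h.eventually (gt_mem_nhds (hV.integral_ne_top 1 le_rfl).lt_top)] with n hn
  have hfin : ∑' x, ENNReal.ofReal (siteFactor V ρ n x ^ 1) ≠ ⊤ := fun h => by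
    rw [h, ENNReal.top_div_of_ne_top ENNReal.ofReal_ne_top] at hn
    exact lt_irrefl _ hn
  have := ENNReal.summable_toReal hfin
  refine this.congr fun x => ?_
  rw [pow_one, ENNReal.toReal_ofReal (siteFactor_mem_Icc V ρ n x).1]

lemma Summable.siteFactor_pow {n : ℕ} (h : Summable (siteFactor V ρ n)) {j : ℕ} (hj : 1 ≤ j) :
    Summable fun x => siteFactor V ρ n x ^ j :=
  h.of_nonneg_of_le (fun x => pow_nonneg (siteFactor_mem_Icc V ρ n x).1 _) fun x =>
    pow_le_of_le_one (siteFactor_mem_Icc V ρ n x).1 (siteFactor_mem_Icc V ρ n x).2 (by omega)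

lemma Summable.siteFactor_mul {n : ℕ} (h : Summable (siteFactor V ρ n)) {ψ : ℝ → ℝ} {C : ℝ}
    (hC : ∀ u ∈ Set.Icc (0 : ℝ) 1, |ψ u| ≤ C) :
    Summable fun x => siteFactor V ρ n x * ψ (siteFactor V ρ n x) := by
  refine Summable.of_norm_bounded (h.mul_left C) fun x => ?_
  rw [Real.norm_eq_abs, abs_mul, abs_of_nonneg (siteFactor_mem_Icc V ρ n x).1, mul_comm]
  exact mul_le_mul_of_nonneg_right (hC _ (siteFactor_mem_Icc V ρ n x))
    (siteFactor_mem_Icc V ρ n x).1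

lemma tendsto_riemannSum_pow (hd : 1 ≤ d) (hρ : 0 < ρ) (hV : AdmissiblePotential V) {j : ℕ}
    (hj : 1 ≤ j) :
    Tendsto (fun n : ℕ => (∑' x, siteFactor V ρ n x ^ j) / (n / ρ)) atTop
      (𝓝 (boltzmannIntegral V j).toReal) := by
  have h := (ENNReal.tendsto_toReal (hV.integral_ne_top j hj)).comp
    (tendsto_riemannSum_ennreal hd hρ hV hj)
  refine h.congr' ?_
  filter_upwards [eventually_summable_siteFactor hd hρ hV] with n hn
  rw [Function.comp_apply, ENNReal.toReal_div, ENNReal.toReal_ofReal (by positivity),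
    ← ENNReal.ofReal_tsum_of_nonneg (fun x => pow_nonneg (siteFactor_mem_Icc V ρ n x).1 _)
      (hn.siteFactor_pow hj),
    ENNReal.toReal_ofReal (tsum_nonneg fun x => pow_nonneg (siteFactor_mem_Icc V ρ n x).1 _)]

lemma AdmissiblePotential.aemeasurable_boltzmannFactor (hV : AdmissiblePotential V) :
    AEMeasurable (fun x => boltzmannFactor (V x)) := by
  have h : Measurable boltzmannFactor := by
    unfold boltzmannFactor boltzmann
    have : Measurable fun v : ℝ≥0∞ => EReal.exp (-(((1 : ℕ) : ℝ≥0∞) * v : ℝ≥0∞)) := by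
      fun_prop
    exact this.ennreal_toReal
  exact h.comp_aemeasurable hV.aemeasurable

lemma lintegral_ofReal_boltzmannFactor_pow (j : ℕ) :
    ∫⁻ x, ENNReal.ofReal (boltzmannFactor (V x) ^ j) = boltzmannIntegral V j :=
  lintegral_congr fun _ => ofReal_boltzmannFactor_pow _ _

lemma AdmissiblePotential.integrable_pow (hV : AdmissiblePotential V) {j : ℕ} (hj : 1 ≤ j) :
    Integrable fun x => boltzmannFactor (V x) ^ j := by
  refine ⟨(hV.aemeasurable_boltzmannFactor.pow_const j).aestronglyMeasurable, ?_⟩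
  rw [hasFiniteIntegral_iff_ofReal
    (ae_of_all _ fun x => pow_nonneg (boltzmannFactor_mem_Icc _).1 _),
    lintegral_ofReal_boltzmannFactor_pow]
  exact (hV.integral_ne_top j hj).lt_top

lemma AdmissiblePotential.integrable_boltzmannFactor (hV : AdmissiblePotential V) :
    Integrable fun x => boltzmannFactor (V x) := by
  simpa using hV.integrable_pow le_rfl

lemma AdmissiblePotential.integral_pow (hV : AdmissiblePotential V) (j : ℕ) :
    ∫ x, boltzmannFactor (V x) ^ j = (boltzmannIntegral V j).toReal := by
  rw [integral_eq_lintegral_of_nonneg_ae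
    (ae_of_all _ fun x => pow_nonneg (boltzmannFactor_mem_Icc _).1 _)
    (hV.aemeasurable_boltzmannFactor.pow_const j).aestronglyMeasurable,
    lintegral_ofReal_boltzmannFactor_pow]

lemma AdmissiblePotential.integrable_mul (hV : AdmissiblePotential V) {ψ : ℝ → ℝ}
    (hψ : Continuous ψ) : Integrable fun x => boltzmannFactor (V x) * ψ (boltzmannFactor (V x)) := by
  obtain ⟨C, hC⟩ := isCompact_Icc.exists_bound_of_continuousOn (s := Set.Icc (0 : ℝ) 1)
    hψ.continuousOn
  refine hV.integrable_boltzmannFactor.mul_bdd (c := C) ?_ ?_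
  · exact (hψ.measurable.comp_aemeasurable hV.aemeasurable_boltzmannFactor).aestronglyMeasurable
  · exact ae_of_all _ fun x => hC _ (boltzmannFactor_mem_Icc _)

lemma tendsto_riemannSum_polynomial (hd : 1 ≤ d) (hρ : 0 < ρ) (hV : AdmissiblePotential V)
    (p : Polynomial ℝ) :
    Tendsto (fun n : ℕ => (∑' x, siteFactor V ρ n x * p.eval (siteFactor V ρ n x)) / (n / ρ)) atTop
      (𝓝 (∫ x, boltzmannFactor (V x) * p.eval (boltzmannFactor (V x)))) := by
  have hsum : ∀ p : Polynomial ℝ, ∀ᶠ n : ℕ in atTop,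
      Summable fun x => siteFactor V ρ n x * p.eval (siteFactor V ρ n x) := by
    intro p
    obtain ⟨C, hC⟩ := isCompact_Icc.exists_bound_of_continuousOn (s := Set.Icc (0 : ℝ) 1)
      p.continuous.continuousOn
    filter_upwards [eventually_summable_siteFactor hd hρ hV] with n hn
    exact hn.siteFactor_mul hC
  induction p using Polynomial.induction_on' with
  | add p q hp hq =>
    have hint : ∫ x, boltzmannFactor (V x) * (p + q).eval (boltzmannFactor (V x)) =
        (∫ x, boltzmannFactor (V x) * p.eval (boltzmannFactor (V x))) +
          ∫ x, boltzmannFactor (V x) * q.eval (boltzmannFactor (V x)) := by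
      rw [← integral_add (hV.integrable_mul p.continuous) (hV.integrable_mul q.continuous)]
      exact integral_congr_ae (ae_of_all _ fun x => by simp [mul_add])
    rw [hint]
    refine (hp.add hq).congr' ?_
    filter_upwards [hsum p, hsum q] with n h1 h2
    rw [← add_div, ← h1.tsum_add h2]
    simp only [Polynomial.eval_add, mul_add]
  | monomial i c =>
    have hint : ∫ x, boltzmannFactor (V x) * (Polynomial.monomial i c).eval (boltzmannFactor (V x)) =
        c * (boltzmannIntegral V (i + 1)).toReal := by
      rw [← hV.integral_pow, ← integral_const_mul]
      refine integral_congr_ae (ae_of_all _ fun x => ?_)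
      simp only [Polynomial.eval_monomial]
      ring
    rw [hint]
    refine ((tendsto_riemannSum_pow hd hρ hV (Nat.le_add_left 1 i)).const_mul c).congr fun n => ?_
    rw [← mul_div_assoc, ← tsum_mul_left]
    congr 1
    refine tsum_congr fun x => ?_
    simp only [Polynomial.eval_monomial]
    ring

/-- The assumption on the Riemann sums of the powers `e^{-jV}` carries over to the functions
`e^{-V} ψ(e^{-V})` with `ψ` continuous, by the Weierstrass approximation theorem. -/
lemma tendsto_riemannSum_of_continuous (hd : 1 ≤ d) (hρ : 0 < ρ) (hV : AdmissiblePotential V)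
    {ψ : ℝ → ℝ} (hψ : Continuous ψ) :
    Tendsto (fun n : ℕ => (∑' x, siteFactor V ρ n x * ψ (siteFactor V ρ n x)) / (n / ρ)) atTop
      (𝓝 (∫ x, boltzmannFactor (V x) * ψ (boltzmannFactor (V x)))) := by
  set I := ∫ x, boltzmannFactor (V x) with hI
  have hI0 : 0 ≤ I := integral_nonneg fun x => (boltzmannFactor_mem_Icc _).1
  have hI1 : Tendsto (fun n : ℕ => (∑' x, siteFactor V ρ n x) / (n / ρ)) atTop (𝓝 I) := by
    have := tendsto_riemannSum_pow hd hρ hV le_rfl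
    rw [← hV.integral_pow] at this
    simpa using this
  refine Metric.tendsto_nhds.2 fun ε hε => ?_
  set δ := ε / (4 * (I + 1)) with hδ
  have hδ0 : 0 < δ := by positivity
  have hδI : δ * (I + 1) = ε / 4 := by
    rw [hδ]
    field_simp
  obtain ⟨p, hp⟩ := exists_polynomial_near_of_continuousOn 0 1 ψ hψ.continuousOn δ hδ0
  obtain ⟨C, hC⟩ := isCompact_Icc.exists_bound_of_continuousOn (s := Set.Icc (0 : ℝ) 1)
    hψ.continuousOn
  obtain ⟨C', hC'⟩ := isCompact_Icc.exists_bound_of_continuousOn (s := Set.Icc (0 : ℝ) 1)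
    p.continuous.continuousOn
  have hlim := tendsto_riemannSum_polynomial hd hρ hV p
  have hclose : |(∫ x, boltzmannFactor (V x) * p.eval (boltzmannFactor (V x))) -
      ∫ x, boltzmannFactor (V x) * ψ (boltzmannFactor (V x))| ≤ δ * I := by
    rw [← integral_sub (hV.integrable_mul p.continuous) (hV.integrable_mul hψ), hI,
      ← integral_const_mul]
    refine (abs_integral_le_integral_abs).trans (integral_mono ?_ ?_ fun x => ?_)
    · exact ((hV.integrable_mul p.continuous).sub (hV.integrable_mul hψ)).abs
    · exact hV.integrable_boltzmannFactor.const_mul _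
    · have hx := boltzmannFactor_mem_Icc (V x)
      simp only
      rw [← mul_sub, abs_mul, abs_of_nonneg hx.1, mul_comm]
      exact mul_le_mul_of_nonneg_right (hp _ hx).le hx.1
  filter_upwards [eventually_summable_siteFactor hd hρ hV,
    Metric.tendsto_nhds.1 hlim (ε / 4) (by positivity),
    hI1.eventually (gt_mem_nhds (lt_add_one I))] with n hn h1 h2
  have hN : (0 : ℝ) ≤ n / ρ := by positivity
  have hd1 : |(∑' x, siteFactor V ρ n x * ψ (siteFactor V ρ n x)) / (n / ρ) -
      (∑' x, siteFactor V ρ n x * p.eval (siteFactor V ρ n x)) / (n / ρ)| ≤ δ * (I + 1) := by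
    rw [← sub_div, ← (hn.siteFactor_mul hC).tsum_sub (hn.siteFactor_mul hC'), abs_div,
      abs_of_nonneg hN]
    refine le_trans (div_le_div_of_nonneg_right ?_ hN)
      (b := (δ * ∑' x, siteFactor V ρ n x) / (n / ρ)) ?_
    · rw [← tsum_mul_left]
      rw [← Real.norm_eq_abs]
      refine tsum_of_norm_bounded (hn.mul_left δ).hasSum fun x => ?_
      have hx := siteFactor_mem_Icc V ρ n x
      rw [Real.norm_eq_abs, ← mul_sub, abs_mul, abs_of_nonneg hx.1, mul_comm, abs_sub_comm]
      exact mul_le_mul_of_nonneg_right (hp _ hx).le hx.1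
    · rw [mul_div_assoc]
      exact mul_le_mul_of_nonneg_left h2.le hδ0.le
  rw [Real.dist_eq] at h1 ⊢
  have hδI' : δ * I ≤ ε / 4 := by rw [← hδI]; gcongr; linarith
  rw [hδI] at hd1
  rw [abs_lt] at h1 ⊢
  rw [abs_le] at hd1 hclose
  constructor <;> linarith [hd1.1, hd1.2, hclose.1, hclose.2, h1.1, h1.2]

/-- The version of `tendsto_riemannSum_of_continuous` for `ψ` continuous on `[0, 1]`. -/
lemma tendsto_riemannSum (hd : 1 ≤ d) (hρ : 0 < ρ) (hV : AdmissiblePotential V)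
    {ψ : ℝ → ℝ} (hψ : ContinuousOn ψ (Set.Icc 0 1)) :
    Tendsto (fun n : ℕ => (∑' x, siteFactor V ρ n x * ψ (siteFactor V ρ n x)) / (n / ρ)) atTop
      (𝓝 (∫ x, boltzmannFactor (V x) * ψ (boltzmannFactor (V x)))) := by
  set ψ' : ℝ → ℝ := Set.IccExtend zero_le_one ((Set.Icc (0 : ℝ) 1).domRestrict ψ) with hψ'
  have hc : Continuous ψ' := hψ.domRestrict.Icc_extend'
  have he : ∀ u ∈ Set.Icc (0 : ℝ) 1, ψ' u = ψ u := fun u hu => by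
    rw [hψ', Set.IccExtend_of_mem _ _ hu, Set.domRestrict_apply]
  have h := tendsto_riemannSum_of_continuous hd hρ hV hc
  simp only [he _ (siteFactor_mem_Icc V ρ _ _), he _ (boltzmannFactor_mem_Icc _)] at h
  exact h

end Riemann

/-! ### Exponential lower bound on the partition function -/

/-- The exponential rate `x log b - x log x + x` of the Poisson weights `(b N)^r / r!`, where
`r ∼ x N`. It vanishes at `x = 0`. -/
noncomputable def poissonRate (b x : ℝ) : ℝ := x * Real.log b + Real.negMulLog x + x

lemma continuous_poissonRate (b : ℝ) : Continuous (poissonRate b) := by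
  unfold poissonRate
  have := Real.continuous_negMulLog
  fun_prop

lemma log_factorial_le (r : ℕ) :
    Real.log (r ! : ℕ) ≤ r * Real.log r - r + Real.log (r + 1) + 1 := by
  rcases r with _ | m
  · simp
  · have h1 : Real.log (Stirling.stirlingSeq (m + 1)) ≤ Real.log (Stirling.stirlingSeq 1) :=
      Stirling.log_stirlingSeq'_antitone (Nat.zero_le m)
    have hm : (0 : ℝ) < (m : ℝ) + 1 := by positivity
    rw [Stirling.log_stirlingSeq_formula, Stirling.log_stirlingSeq_formula] at h1
    push_cast at h1 ⊢
    rw [Real.log_mul two_ne_zero hm.ne', Real.log_div hm.ne' (Real.exp_pos 1).ne',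
      Real.log_exp] at h1
    simp only [Nat.factorial_one, Nat.cast_one, Real.log_one, mul_one, one_mul, one_div,
      Real.log_inv, Real.log_exp] at h1
    have h2 : Real.log ((m : ℝ) + 1) ≤ Real.log ((m : ℝ) + 1 + 1) :=
      Real.log_le_log hm (by linarith)
    have h3 : 0 ≤ Real.log ((m : ℝ) + 1) := Real.log_nonneg (by linarith)
    nlinarith

lemma le_log_poisson {b N : ℝ} (hb : 0 < b) (hN : 0 < N) (r : ℕ) :
    N * poissonRate b (r / N) - Real.log (r + 1) - 1 ≤
      Real.log ((b * N) ^ r * ((r ! : ℕ) : ℝ)⁻¹) := by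
  have hf : ((r ! : ℕ) : ℝ) ≠ 0 := by positivity
  rw [Real.log_mul (by positivity) (by positivity), Real.log_inv, Real.log_pow,
    Real.log_mul hb.ne' hN.ne']
  have h := log_factorial_le r
  have h2 : N * poissonRate b (r / N) =
      r * (Real.log b + Real.log N) - r * Real.log r + r := by
    unfold poissonRate Real.negMulLog
    rcases Nat.eq_zero_or_pos r with rfl | hr
    · simp
    · have hr' : (r : ℝ) ≠ 0 := by exact_mod_cast hr.ne'
      rw [Real.log_div hr' hN.ne']
      field_simp
      ring
  linarith

/-- Since `V` is continuous at `0` and vanishes there, the integrals `∫ e^{-jV}` do not decay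
exponentially in `j`. -/
lemma exists_le_boltzmannIntegral {d : ℕ} {V : (Fin d → ℝ) → ℝ≥0∞} (hV : AdmissiblePotential V)
    {q : ℝ} (hq0 : 0 < q) (hq1 : q < 1) :
    ∃ c : ℝ, 0 < c ∧ ∀ j : ℕ, ENNReal.ofReal (c * q ^ j) ≤ boltzmannIntegral V j := by
  have hlog : 0 < -Real.log q := neg_pos.2 (Real.log_neg hq0 hq1)
  have hnhds : {x | V x < ENNReal.ofReal (-Real.log q)} ∈ 𝓝 (0 : Fin d → ℝ) := by
    apply hV.continuousAt_zero.eventually_lt_const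
    rw [hV.map_zero]
    exact ENNReal.ofReal_pos.2 hlog
  obtain ⟨U, hU, hUo, h0U⟩ := mem_nhds_iff.1 hnhds
  have hvol : 0 < volume U := hUo.measure_pos volume ⟨0, h0U⟩
  obtain ⟨c, hc0, hc⟩ := ENNReal.lt_iff_exists_nnreal_btwn.1 hvol
  refine ⟨c, by exact_mod_cast hc0, fun j => ?_⟩
  have hb : ∀ x ∈ U, ENNReal.ofReal (q ^ j) ≤ boltzmann j (V x) := by
    intro x hx
    rw [boltzmann_eq_pow, ENNReal.ofReal_pow hq0.le]
    gcongr
    have hx' : V x ≤ ENNReal.ofReal (-Real.log q) := (hU hx).le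
    have : ENNReal.ofReal q = boltzmann 1 (ENNReal.ofReal (-Real.log q)) := by
      have h1 : (((1 : ℕ) : ℝ≥0∞) * ENNReal.ofReal (-Real.log q) : ℝ≥0∞) =
          ENNReal.ofReal (-Real.log q) := by simp
      rw [boltzmann, h1, EReal.coe_ennreal_ofReal, max_eq_left hlog.le, ← EReal.coe_neg,
        EReal.exp_coe, neg_neg, Real.exp_log hq0]
    rw [this]
    unfold boltzmann
    apply EReal.exp_monotone
    rw [EReal.neg_le_neg_iff]
    exact EReal.coe_ennreal_le_coe_ennreal_iff.2 (by gcongr)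
  calc ENNReal.ofReal (c * q ^ j) = ENNReal.ofReal (q ^ j) * c := by
        rw [mul_comm, ENNReal.ofReal_mul (by positivity), ENNReal.ofReal_coe_nnreal]
    _ ≤ ENNReal.ofReal (q ^ j) * volume U := by gcongr
    _ = ∫⁻ _ in U, ENNReal.ofReal (q ^ j) := by rw [setLIntegral_const]
    _ ≤ ∫⁻ x in U, boltzmann j (V x) := setLIntegral_mono' hUo.measurableSet hb
    _ ≤ boltzmannIntegral V j := setLIntegral_le_lintegral _ _

lemma boltzmannIntegral_pos {d : ℕ} {V : (Fin d → ℝ) → ℝ≥0∞} (hV : AdmissiblePotential V) (j : ℕ) :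
    0 < boltzmannIntegral V j := by
  obtain ⟨c, hc, h⟩ := exists_le_boltzmannIntegral hV (q := 1 / 2) (by norm_num) (by norm_num)
  exact lt_of_lt_of_le (ENNReal.ofReal_pos.2 (by positivity)) (h j)

lemma toReal_boltzmannIntegral_pos {d : ℕ} {V : (Fin d → ℝ) → ℝ≥0∞} (hV : AdmissiblePotential V)
    (j : ℕ+) : 0 < (boltzmannIntegral V j).toReal :=
  ENNReal.toReal_pos (boltzmannIntegral_pos hV j).ne' (hV.integral_ne_top j j.pos)

/-- The sizes below a given bound that are possible at all are realised at a bounded cost. -/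
lemma exists_exp_le_siteWeight (θ : ℕ → ℝ≥0) (B : ℕ) :
    ∃ c : ℝ, ∀ m < B, m ∈ AddSubmonoid.closure {j : ℕ | 1 ≤ j ∧ θ j ≠ 0} →
      ∃ s : ℕ+ →₀ ℕ, partSize s = m ∧ ENNReal.ofReal (Real.exp (-c)) ≤ siteWeight θ 1 s := by
  induction B with
  | zero => exact ⟨0, by simp⟩
  | succ B ih =>
    obtain ⟨c, hc⟩ := ih
    have hlast : ∃ c' : ℝ, B ∈ AddSubmonoid.closure {j : ℕ | 1 ≤ j ∧ θ j ≠ 0} →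
        ∃ s : ℕ+ →₀ ℕ, partSize s = B ∧ ENNReal.ofReal (Real.exp (-c')) ≤ siteWeight θ 1 s := by
      by_cases hB : B ∈ AddSubmonoid.closure {j : ℕ | 1 ≤ j ∧ θ j ≠ 0}
      · obtain ⟨s, hs, hs'⟩ := exists_siteWeight_ne_zero θ hB
        obtain ⟨w, hw0, hw⟩ := ENNReal.lt_iff_exists_nnreal_btwn.1
          (pos_iff_ne_zero.2 (siteWeight_ne_zero hs'))
        have hw0' : (0 : ℝ) < w := by exact_mod_cast hw0
        refine ⟨-Real.log w, fun _ => ⟨s, hs, ?_⟩⟩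
        rw [neg_neg, Real.exp_log hw0', ENNReal.ofReal_coe_nnreal]
        exact hw.le
      · exact ⟨0, fun h => absurd h hB⟩
    obtain ⟨c', hc'⟩ := hlast
    refine ⟨max c c', fun m hm hmem => ?_⟩
    rcases Nat.lt_succ_iff_lt_or_eq.1 hm with h | rfl
    · obtain ⟨s, hs, hs'⟩ := hc m h hmem
      exact ⟨s, hs, le_trans (ENNReal.ofReal_le_ofReal (Real.exp_le_exp.2
        (neg_le_neg (le_max_left _ _)))) hs'⟩
    · obtain ⟨s, hs, hs'⟩ := hc' hmem
      exact ⟨s, hs, le_trans (ENNReal.ofReal_le_ofReal (Real.exp_le_exp.2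
        (neg_le_neg (le_max_right _ _)))) hs'⟩

/-- Integer multiplicities approximating the densities `α_j`. The multiplicity of `j₀` is adjusted
so that the total size falls short of `n` by an amount in `[K, K + j₀)`. -/
lemma exists_multiplicities {ρ : ℝ} (hρ : 0 < ρ) (F : Finset ℕ+) (α : ℕ+ → ℝ)
    (hα : ∀ j ∈ F, 0 ≤ α j) (hsum : ∑ j ∈ F, (j : ℕ) * α j = ρ) {j₀ : ℕ+} (hj₀ : j₀ ∈ F)
    (hα₀ : 0 < α j₀) (K : ℕ) :
    ∃ r : ℕ → ℕ+ → ℕ, (∀ j ∈ F, Tendsto (fun n : ℕ => (r n j : ℝ) / (n / ρ)) atTop (𝓝 (α j))) ∧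
      ∀ᶠ n : ℕ in atTop, ∃ m, K ≤ m ∧ m < K + j₀ ∧ m + ∑ j ∈ F, (j : ℕ) * r n j = n := by
  classical
  have hN := tendsto_natCast_div_atTop hρ
  set S : ℕ → ℕ := fun n => ∑ j ∈ F.erase j₀, (j : ℕ) * ⌊α j * (n / ρ)⌋₊ with hS
  set r : ℕ → ℕ+ → ℕ := fun n j => if j = j₀ then (n - S n - K) / (j₀ : ℕ)
    else ⌊α j * (n / ρ)⌋₊ with hr
  have hj₀pos : (0 : ℝ) < ((j₀ : ℕ) : ℝ) := by exact_mod_cast j₀.pos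
  have hfloor : ∀ j ∈ F, Tendsto (fun n : ℕ => ((⌊α j * (n / ρ)⌋₊ : ℕ) : ℝ) / (n / ρ)) atTop
      (𝓝 (α j)) := fun j hj => (tendsto_nat_floor_mul_div_atTop (hα j hj)).comp hN
  have hsplit : ∑ j ∈ F.erase j₀, ((j : ℕ) : ℝ) * α j = ρ - (j₀ : ℕ) * α j₀ := by
    rw [← hsum, ← Finset.add_sum_erase F _ hj₀]
    ring
  have hSlim : Tendsto (fun n : ℕ => (S n : ℝ) / (n / ρ)) atTop (𝓝 (ρ - (j₀ : ℕ) * α j₀)) := by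
    rw [← hsplit]
    have h := tendsto_finsetSum (F.erase j₀) fun j hj =>
      (hfloor j (Finset.mem_of_mem_erase hj)).const_mul ((j : ℕ) : ℝ)
    refine h.congr fun n => ?_
    simp only [hS]
    push_cast
    rw [Finset.sum_div]
    exact Finset.sum_congr rfl fun j _ => by ring
  have hlim : Tendsto (fun n : ℕ => ((n : ℝ) - S n - K) / (n / ρ)) atTop (𝓝 ((j₀ : ℕ) * α j₀)) := by
    have h1 : Tendsto (fun n : ℕ => (n : ℝ) / (n / ρ)) atTop (𝓝 ρ) := by
      refine tendsto_const_nhds.congr' ?_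
      filter_upwards [eventually_gt_atTop 0] with n hn
      have : (n : ℝ) ≠ 0 := by exact_mod_cast hn.ne'
      field_simp
    have h := (h1.sub hSlim).sub ((tendsto_const_nhds (x := (K : ℝ))).div_atTop hN)
    have he : ρ - (ρ - (j₀ : ℕ) * α j₀) - 0 = (j₀ : ℕ) * α j₀ := by ring
    rw [he] at h
    exact h.congr fun n => by rw [sub_div, sub_div]
  have hge : ∀ᶠ n : ℕ in atTop, S n + K ≤ n := by
    filter_upwards [hlim.eventually (lt_mem_nhds (mul_pos hj₀pos hα₀)),
      eventually_gt_atTop 0] with n hn hn0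
    have hN0 : (0 : ℝ) < n / ρ := by positivity
    have := (div_pos_iff_of_pos_right hN0).1 hn
    have h' : ((S n + K : ℕ) : ℝ) ≤ n := by push_cast; linarith
    exact_mod_cast h'
  refine ⟨r, fun j hj => ?_, ?_⟩
  · by_cases h : j = j₀
    · subst h
      simp only [hr, if_true]
      have hlim' : Tendsto (fun n : ℕ => ((n : ℝ) - S n - K) / (j : ℕ) / (n / ρ)) atTop
          (𝓝 (α j)) := by
        have := hlim.div_const ((j : ℕ) : ℝ)
        rw [mul_div_cancel_left₀ _ hj₀pos.ne'] at this
        exact this.congr fun n => by rw [div_right_comm]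
      have hlow : Tendsto (fun n : ℕ => (((n : ℝ) - S n - K) / (j : ℕ) - 1) / (n / ρ)) atTop
          (𝓝 (α j)) := by
        have := hlim'.sub ((tendsto_const_nhds (x := (1 : ℝ))).div_atTop hN)
        rw [sub_zero] at this
        exact this.congr fun n => by ring
      refine tendsto_of_tendsto_of_tendsto_of_le_of_le' hlow hlim' ?_ ?_
      · filter_upwards [hge] with n hn
        have hc : ((n - S n - K : ℕ) : ℝ) = (n : ℝ) - S n - K := by
          rw [Nat.cast_sub (by omega), Nat.cast_sub (by omega)]
        refine div_le_div_of_nonneg_right ?_ (by positivity)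
        rw [← hc, ← Nat.floor_div_eq_div (K := ℝ)]
        exact (Nat.sub_one_lt_floor _).le
      · filter_upwards [hge] with n hn
        have hc : ((n - S n - K : ℕ) : ℝ) = (n : ℝ) - S n - K := by
          rw [Nat.cast_sub (by omega), Nat.cast_sub (by omega)]
        refine div_le_div_of_nonneg_right ?_ (by positivity)
        rw [← hc]
        exact Nat.cast_div_le
    · simp only [hr, h, if_false]
      exact hfloor j hj
  · filter_upwards [hge] with n hn
    refine ⟨K + (n - S n - K) % (j₀ : ℕ), Nat.le_add_right _ _,
      Nat.add_lt_add_left (Nat.mod_lt _ j₀.pos) _, ?_⟩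
    have hsum' : ∑ j ∈ F, (j : ℕ) * r n j = (j₀ : ℕ) * ((n - S n - K) / (j₀ : ℕ)) + S n := by
      rw [← Finset.add_sum_erase F _ hj₀]
      congr 1
      · simp [hr]
      · exact Finset.sum_congr rfl fun j hj => by simp [hr, Finset.ne_of_mem_erase hj]
    rw [hsum']
    have := Nat.mod_add_div (n - S n - K) (j₀ : ℕ)
    omega

/-- Finitely many sites other than `0` carry almost all of the Riemann sums. -/
lemma eventually_exists_sites {d : ℕ} (hd : 1 ≤ d) {ρ : ℝ} (hρ : 0 < ρ)
    {V : (Fin d → ℝ) → ℝ≥0∞} (hV : AdmissiblePotential V) (F : Finset ℕ+) {δ : ℝ} (hδ : 0 < δ) :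
    ∀ᶠ n : ℕ in atTop, ∃ A : Finset (Fin d → ℤ), 0 ∉ A ∧ ∀ j ∈ F,
      Real.exp (-δ) * (boltzmannIntegral V j).toReal * (n / ρ) ≤
        ∑ x ∈ A, siteFactor V ρ n x ^ (j : ℕ) := by
  classical
  have hlim : ∀ j ∈ F, ∀ᶠ n : ℕ in atTop,
      Real.exp (-δ) * (boltzmannIntegral V j).toReal * (n / ρ) + 1 <
        ∑' x, siteFactor V ρ n x ^ (j : ℕ) := by
    intro j _
    have hI := toReal_boltzmannIntegral_pos hV j
    have h := (tendsto_riemannSum_pow hd hρ hV j.pos).sub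
      ((tendsto_const_nhds (x := (1 : ℝ))).div_atTop (tendsto_natCast_div_atTop hρ))
    rw [sub_zero] at h
    have hlt : Real.exp (-δ) * (boltzmannIntegral V j).toReal < (boltzmannIntegral V j).toReal :=
      mul_lt_of_lt_one_left hI (by simpa using hδ)
    filter_upwards [h.eventually (lt_mem_nhds hlt), eventually_gt_atTop 0] with n hn hn0
    have hN0 : (0 : ℝ) < n / ρ := by positivity
    rw [← sub_div, lt_div_iff₀ hN0] at hn
    linarith
  filter_upwards [eventually_summable_siteFactor hd hρ hV,
    (Filter.eventually_all_finset F).2 hlim] with n hn hn'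
  have hA : ∀ᶠ A : Finset (Fin d → ℤ) in atTop, ∀ j ∈ F,
      Real.exp (-δ) * (boltzmannIntegral V j).toReal * (n / ρ) + 1 <
        ∑ x ∈ A, siteFactor V ρ n x ^ (j : ℕ) :=
    (Filter.eventually_all_finset F).2 fun j hj =>
      (hn.siteFactor_pow j.pos).hasSum.eventually (lt_mem_nhds (hn' j hj))
  obtain ⟨A, hA, hA0⟩ := (hA.and (eventually_ge_atTop {(0 : Fin d → ℤ)})).exists
  refine ⟨A.erase 0, Finset.notMem_erase _ _, fun j hj => ?_⟩
  have h0 : (0 : Fin d → ℤ) ∈ A := hA0 (Finset.mem_singleton_self _)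
  have h1 := hA j hj
  rw [← Finset.add_sum_erase A _ h0] at h1
  have h2 : siteFactor V ρ n 0 ^ (j : ℕ) ≤ 1 :=
    pow_le_one₀ (siteFactor_mem_Icc V ρ n 0).1 (siteFactor_mem_Icc V ρ n 0).2
  linarith

lemma tendsto_log_div_atTop {ρ : ℝ} (hρ : 0 < ρ) :
    Tendsto (fun n : ℕ => Real.log ((n : ℝ) + 1) / (n / ρ)) atTop (𝓝 0) := by
  have h1 : Tendsto (fun n : ℕ => Real.log ((n : ℝ) + 1) / ((n : ℝ) + 1)) atTop (𝓝 0) := by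
    have h := Real.isLittleO_log_id_atTop.tendsto_div_nhds_zero
    exact h.comp (tendsto_atTop_add_const_right _ 1 tendsto_natCast_atTop_atTop)
  have h2 : Tendsto (fun n : ℕ => ((n : ℝ) + 1) / n) atTop (𝓝 1) := by
    have h := (tendsto_const_nhds (x := (1 : ℝ))).add
      ((tendsto_const_nhds (x := (1 : ℝ))).div_atTop tendsto_natCast_atTop_atTop)
    rw [add_zero] at h
    refine h.congr' ?_
    filter_upwards [eventually_gt_atTop 0] with n hn
    have : (n : ℝ) ≠ 0 := by exact_mod_cast hn.ne'
    rw [add_div, div_self this]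
  have h := (h1.mul h2).mul_const ρ
  rw [zero_mul, zero_mul] at h
  refine h.congr' ?_
  filter_upwards [eventually_gt_atTop 0] with n hn
  have : (n : ℝ) ≠ 0 := by exact_mod_cast hn.ne'
  field_simp

/-- Exponential lower bound: prescribing densities `α_j` of finitely many parts, of total size `ρ`,
gives a lower bound on `Z_{L,n}` for all large `n` with `Z_{L,n} > 0`. -/
lemma eventually_le_partitionFunction {d : ℕ} (hd : 1 ≤ d) {ρ : ℝ} (hρ : 0 < ρ) {θ : ℕ → ℝ≥0}
    {V : (Fin d → ℝ) → ℝ≥0∞} (hV : AdmissiblePotential V) (F : Finset ℕ+)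
    (hF : ∀ j ∈ F, θ j ≠ 0) (α : ℕ+ → ℝ) (hα : ∀ j ∈ F, 0 ≤ α j)
    (hsum : ∑ j ∈ F, (j : ℕ) * α j = ρ) {j₀ : ℕ+} (hj₀ : j₀ ∈ F) (hα₀ : 0 < α j₀)
    {η : ℝ} (hη : 0 < η) :
    ∀ᶠ n : ℕ in thermodynamicLimit θ V ρ,
      ENNReal.ofReal (Real.exp (n / ρ *
        ((∑ j ∈ F, poissonRate ((θ j : ℝ) / (j : ℕ) * (boltzmannIntegral V j).toReal) (α j)) - η)))
        ≤ partitionFunction θ V (lengthAt d ρ n) n := by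
  classical
  set b : ℕ+ → ℝ := fun j => (θ j : ℝ) / (j : ℕ) * (boltzmannIntegral V j).toReal with hb
  have hθ : ∀ j ∈ F, (0 : ℝ) < (θ j : ℝ) / (j : ℕ) := fun j hj =>
    div_pos (by exact_mod_cast pos_iff_ne_zero.2 (hF j hj)) (by exact_mod_cast j.pos)
  have hbpos : ∀ j ∈ F, 0 < b j := fun j hj => mul_pos (hθ j hj) (toReal_boltzmannIntegral_pos hV j)
  obtain ⟨K, hK⟩ := Nat.exists_mem_closure_of_ge {j : ℕ | 1 ≤ j ∧ θ j ≠ 0}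
  obtain ⟨c, hc⟩ := exists_exp_le_siteWeight θ (K + j₀)
  obtain ⟨r, hr, hrsum⟩ := exists_multiplicities hρ F α hα hsum hj₀ hα₀ K
  set δ := η / (2 * (∑ j ∈ F, α j + 1)) with hδ
  have hαsum : 0 ≤ ∑ j ∈ F, α j := Finset.sum_nonneg hα
  have hδ0 : 0 < δ := by positivity
  have hδα : δ * ∑ j ∈ F, α j ≤ η / 2 := by
    rw [hδ, div_mul_eq_mul_div, div_le_div_iff₀ (by positivity) two_pos]
    nlinarith
  have hrate : ∀ j ∈ F, poissonRate (Real.exp (-δ) * b j) (α j) =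
      poissonRate (b j) (α j) - δ * α j := by
    intro j hj
    unfold poissonRate
    rw [Real.log_mul (Real.exp_pos _).ne' (hbpos j hj).ne', Real.log_exp]
    ring
  have hlim : Tendsto (fun n : ℕ => (∑ j ∈ F, poissonRate (Real.exp (-δ) * b j) (r n j / (n / ρ)))
      - (F.card * (Real.log ((n : ℝ) + 1) / (n / ρ)) + (F.card + c) / (n / ρ))) atTop
      (𝓝 (∑ j ∈ F, poissonRate (Real.exp (-δ) * b j) (α j) - (F.card * 0 + 0))) := by
    refine Tendsto.sub (tendsto_finsetSum F fun j hj => ?_) (Tendsto.add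
      ((tendsto_log_div_atTop hρ).const_mul _)
      (tendsto_const_nhds.div_atTop (tendsto_natCast_div_atTop hρ)))
    exact ((continuous_poissonRate _).tendsto _).comp (hr j hj)
  have hlt : (∑ j ∈ F, poissonRate (b j) (α j)) - η <
      ∑ j ∈ F, poissonRate (Real.exp (-δ) * b j) (α j) - (F.card * 0 + 0) := by
    rw [Finset.sum_congr rfl hrate, Finset.sum_sub_distrib, ← Finset.mul_sum]
    linarith
  have hmain : ∀ᶠ n : ℕ in atTop, n ∈ {n | partitionFunction θ V (lengthAt d ρ n) n ≠ 0} →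
      ENNReal.ofReal (Real.exp (n / ρ * ((∑ j ∈ F, poissonRate (b j) (α j)) - η)))
        ≤ partitionFunction θ V (lengthAt d ρ n) n := by
    filter_upwards [hrsum, hlim.eventually (lt_mem_nhds hlt),
      eventually_exists_sites hd hρ hV F hδ0, eventually_gt_atTop 0] with n hn1 hn2 hn3 hn0 hZ
    obtain ⟨m, hKm, hmK, hm⟩ := hn1
    obtain ⟨A, hA0, hA⟩ := hn3
    have hN0 : (0 : ℝ) < n / ρ := by positivity
    have hdvd : ∀ i ∈ AddSubmonoid.closure {j : ℕ | 1 ≤ j ∧ θ j ≠ 0},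
        Nat.setGcd {j : ℕ | 1 ≤ j ∧ θ j ≠ 0} ∣ i := by
      intro i hi
      induction hi using AddSubmonoid.closure_induction with
      | mem j hj => exact Nat.setGcd_dvd_of_mem hj
      | zero => exact dvd_zero _
      | add x y _ _ hx hy => exact dvd_add hx hy
    -- The remainder `m` lies in the semigroup, being large and divisible by its gcd.
    have hmem : m ∈ AddSubmonoid.closure {j : ℕ | 1 ≤ j ∧ θ j ≠ 0} := by
      refine hK m hKm ?_
      have h1 := hdvd n (mem_closure_of_partitionFunction_ne_zero θ V _ hZ)
      rw [← hm] at h1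
      refine (Nat.dvd_add_left (Finset.dvd_sum fun j hj => ?_)).1 h1
      exact Dvd.dvd.mul_right (Nat.setGcd_dvd_of_mem (s := {j : ℕ | 1 ≤ j ∧ θ j ≠ 0})
        ⟨j.pos, hF j hj⟩) _
    obtain ⟨s₀, hs₀, hws₀⟩ := hc m hmK hmem
    refine le_trans ?_ (le_partitionFunction θ V hV.map_zero (lengthAt d ρ n) s₀ A hA0 F (r n)
      (by rw [hs₀, hm]))
    have hterm : ∀ j ∈ F, ENNReal.ofReal (Real.exp (n / ρ *
          poissonRate (Real.exp (-δ) * b j) (r n j / (n / ρ)) - Real.log ((n : ℝ) + 1) - 1)) ≤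
        (∑ x ∈ A, (θ j : ℝ≥0∞) / ((j : ℕ) : ℝ≥0∞) *
          boltzmann j (V (scaledSite (lengthAt d ρ n) x))) ^ r n j *
          (((r n j)! : ℕ) : ℝ≥0∞)⁻¹ := by
      intro j hj
      have hβ : 0 < Real.exp (-δ) * b j := mul_pos (Real.exp_pos _) (hbpos j hj)
      have hle := le_log_poisson hβ hN0 (r n j)
      have hrn : r n j ≤ n := by
        have h1 := Finset.single_le_sum (f := fun j : ℕ+ => (j : ℕ) * r n j)
          (fun i _ => Nat.zero_le _) hj
        have h2 : r n j ≤ (j : ℕ) * r n j := Nat.le_mul_of_pos_left _ j.pos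
        omega
      have hlog : Real.log ((r n j : ℝ) + 1) ≤ Real.log ((n : ℝ) + 1) :=
        Real.log_le_log (by positivity) (by gcongr)
      calc _ ≤ ENNReal.ofReal ((Real.exp (-δ) * b j * (n / ρ)) ^ r n j * (((r n j)! : ℕ) : ℝ)⁻¹) := by
            refine ENNReal.ofReal_le_ofReal ((Real.le_log_iff_exp_le (by positivity)).1 ?_)
            linarith
        _ = ENNReal.ofReal (Real.exp (-δ) * b j * (n / ρ)) ^ r n j * (((r n j)! : ℕ) : ℝ≥0∞)⁻¹ := by
            rw [ENNReal.ofReal_mul (by positivity), ENNReal.ofReal_pow (by positivity),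
              ENNReal.ofReal_inv_of_pos (by positivity), ENNReal.ofReal_natCast]
        _ ≤ _ := by
            gcongr
            rw [← Finset.mul_sum]
            have hB : ∑ x ∈ A, boltzmann j (V (scaledSite (lengthAt d ρ n) x)) =
                ENNReal.ofReal (∑ x ∈ A, siteFactor V ρ n x ^ (j : ℕ)) := by
              rw [ENNReal.ofReal_sum_of_nonneg fun x _ =>
                pow_nonneg (siteFactor_mem_Icc V ρ n x).1 _]
              exact Finset.sum_congr rfl fun x _ => (ofReal_boltzmannFactor_pow _ _).symm
            have hT : (θ j : ℝ≥0∞) / ((j : ℕ) : ℝ≥0∞) = ENNReal.ofReal ((θ j : ℝ) / (j : ℕ)) := by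
              rw [ENNReal.ofReal_div_of_pos (by exact_mod_cast j.pos), ENNReal.ofReal_coe_nnreal,
                ENNReal.ofReal_natCast]
            rw [hB, hT, ← ENNReal.ofReal_mul (hθ j hj).le]
            refine ENNReal.ofReal_le_ofReal ?_
            have := mul_le_mul_of_nonneg_left (hA j hj) (hθ j hj).le
            simp only [hb]
            linarith
    calc _ ≤ ENNReal.ofReal (Real.exp (-c)) * ∏ j ∈ F, ENNReal.ofReal (Real.exp (n / ρ *
          poissonRate (Real.exp (-δ) * b j) (r n j / (n / ρ)) - Real.log ((n : ℝ) + 1) - 1)) := by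
          rw [← ENNReal.ofReal_prod_of_nonneg fun j _ => Real.exp_nonneg _, ← Real.exp_sum,
            ← ENNReal.ofReal_mul (Real.exp_nonneg _), ← Real.exp_add]
          refine ENNReal.ofReal_le_ofReal (Real.exp_le_exp.2 ?_)
          have h3 := mul_le_mul_of_nonneg_left hn2.le hN0.le
          refine h3.trans (le_of_eq ?_)
          rw [Finset.sum_sub_distrib, Finset.sum_sub_distrib, ← Finset.mul_sum, Finset.sum_const,
            Finset.sum_const, nsmul_eq_mul, nsmul_eq_mul]
          field_simp
          ring
      _ ≤ _ := mul_le_mul' hws₀ (Finset.prod_le_prod' hterm)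
  exact eventually_inf_principal.2 hmain

/-! ### The density and the activity -/

section Activity

variable {d : ℕ} {θ : ℕ → ℝ≥0} {V : (Fin d → ℝ) → ℝ≥0∞} {ρ : ℝ}

/-- The coefficients `θ_j / j ∫ e^{-jV}` of the pressure, whose terms `b_j z^j` are the limiting
densities of the parts equal to `j` at activity `z`. -/
noncomputable def pressureCoeff (θ : ℕ → ℝ≥0) (V : (Fin d → ℝ) → ℝ≥0∞) (j : ℕ+) : ℝ :=
  (θ j : ℝ) / (j : ℕ) * (boltzmannIntegral V j).toReal

lemma pressureCoeff_nonneg (j : ℕ+) : 0 ≤ pressureCoeff θ V j := by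
  unfold pressureCoeff
  positivity

lemma pressureCoeff_pos (hV : AdmissiblePotential V) {j : ℕ+} (hj : θ j ≠ 0) :
    0 < pressureCoeff θ V j :=
  mul_pos (div_pos (by exact_mod_cast pos_iff_ne_zero.2 hj) (by exact_mod_cast j.pos))
    (toReal_boltzmannIntegral_pos hV j)

lemma natCast_mul_pressureCoeff (j : ℕ+) :
    ((j : ℕ) : ℝ) * pressureCoeff θ V j = θ j * (boltzmannIntegral V j).toReal := by
  have : ((j : ℕ) : ℝ) ≠ 0 := by exact_mod_cast j.ne_zero
  unfold pressureCoeff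
  field_simp

lemma toReal_density_term (z : ℝ≥0) (j : ℕ+) :
    ((θ j : ℝ≥0∞) * (z : ℝ≥0∞) ^ (j : ℕ) * boltzmannIntegral V j).toReal =
      (j : ℕ) * (pressureCoeff θ V j * (z : ℝ) ^ (j : ℕ)) := by
  rw [← mul_assoc, natCast_mul_pressureCoeff]
  simp only [ENNReal.toReal_mul, ENNReal.toReal_pow, ENNReal.coe_toReal]
  ring

lemma density_term_ne_top (hV : AdmissiblePotential V) (z : ℝ≥0) (j : ℕ+) :
    (θ j : ℝ≥0∞) * (z : ℝ≥0∞) ^ (j : ℕ) * boltzmannIntegral V j ≠ ∞ :=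
  ENNReal.mul_ne_top (ENNReal.mul_ne_top ENNReal.coe_ne_top
    (ENNReal.pow_ne_top ENNReal.coe_ne_top)) (hV.integral_ne_top j j.pos)

lemma hasSum_density (hV : AdmissiblePotential V) {z : ℝ≥0} (hz : density θ V z ≠ ∞) :
    HasSum (fun j : ℕ+ => (j : ℕ) * (pressureCoeff θ V j * (z : ℝ) ^ (j : ℕ)))
      (density θ V z).toReal := by
  simp only [← toReal_density_term]
  rw [density, ENNReal.tsum_toReal_eq (density_term_ne_top hV z)]
  exact (ENNReal.summable_toReal hz).hasSum

lemma density_eq_ofReal (hV : AdmissiblePotential V) {z : ℝ≥0}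
    (hz : Summable fun j : ℕ+ => (j : ℕ) * (pressureCoeff θ V j * (z : ℝ) ^ (j : ℕ))) :
    density θ V z =
      ENNReal.ofReal (∑' j : ℕ+, (j : ℕ) * (pressureCoeff θ V j * (z : ℝ) ^ (j : ℕ))) := by
  rw [ENNReal.ofReal_tsum_of_nonneg _ hz]
  · refine tsum_congr fun j => ?_
    rw [← toReal_density_term, ENNReal.ofReal_toReal (density_term_ne_top hV z j)]
  · exact fun j => mul_nonneg (Nat.cast_nonneg _)
      (mul_nonneg (pressureCoeff_nonneg j) (by positivity))

lemma density_mono {z z' : ℝ≥0∞} (h : z ≤ z') : density θ V z ≤ density θ V z' :=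
  ENNReal.tsum_le_tsum fun j => by gcongr

lemma density_strictMono (hV : AdmissiblePotential V) {j₁ : ℕ+} (hj₁ : θ j₁ ≠ 0) {z z' : ℝ≥0}
    (h : z < z') (hz : density θ V z ≠ ∞) : density θ V z < density θ V z' := by
  by_cases hz' : density θ V z' = ∞
  · rw [hz']
    exact hz.lt_top
  · rw [← ENNReal.toReal_lt_toReal hz hz']
    have hz1 := hasSum_density hV hz
    have hz2 := hasSum_density hV hz'
    refine hasSum_lt (i := j₁) (fun j => ?_) ?_ hz1 hz2
    · have := pressureCoeff_nonneg (θ := θ) (V := V) j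
      have hzz : (z : ℝ) ≤ z' := by exact_mod_cast h.le
      dsimp only
      gcongr
    · have := pressureCoeff_pos (θ := θ) hV hj₁
      have hzz : (z : ℝ) < z' := by exact_mod_cast h
      have hj : (0 : ℝ) < (j₁ : ℕ) := by exact_mod_cast j₁.pos
      exact mul_lt_mul_of_pos_left (mul_lt_mul_of_pos_left
        (pow_lt_pow_left₀ hzz z.2 j₁.ne_zero) this) hj

lemma density_ne_top_of_lt {z : ℝ≥0} (h : (z : ℝ≥0∞) < criticalActivity θ V) :
    density θ V z ≠ ∞ := by
  obtain ⟨z', hz'⟩ := lt_iSup_iff.1 h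
  obtain ⟨hfin, hlt⟩ := lt_iSup_iff.1 hz'
  exact ne_top_of_le_ne_top hfin (density_mono hlt.le)

lemma le_criticalActivity {z : ℝ≥0} (h : density θ V z ≠ ∞) :
    (z : ℝ≥0∞) ≤ criticalActivity θ V :=
  le_iSup₂_of_le z h le_rfl

lemma density_zero : density θ V 0 = 0 := by
  simp [density]

/-- The density is continuous from the left at the critical activity, which may be infinite, as a
supremum of continuous functions. -/
lemma exists_density_gt (hV : AdmissiblePotential V) (hzc : 0 < criticalActivity θ V)
    (h : ENNReal.ofReal ρ < criticalDensity θ V) :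
    ∃ z : ℝ≥0, (z : ℝ≥0∞) < criticalActivity θ V ∧ ENNReal.ofReal ρ < density θ V z := by
  rw [criticalDensity, density, ENNReal.tsum_eq_iSup_sum] at h
  obtain ⟨s, hs⟩ := lt_iSup_iff.1 h
  have hcont : Continuous fun z : ℝ≥0∞ =>
      ∑ j ∈ s, (θ (j : ℕ) : ℝ≥0∞) * z ^ (j : ℕ) * boltzmannIntegral V j := by
    refine continuous_finsetSum _ fun j _ => ?_
    refine (ENNReal.continuous_mul_const (hV.integral_ne_top j j.pos)).comp ?_
    exact (ENNReal.continuous_const_mul ENNReal.coe_ne_top).comp (ENNReal.continuous_pow _)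
  have hev := (hcont.tendsto (criticalActivity θ V)).eventually (lt_mem_nhds hs)
  have hne : (𝓝[<] criticalActivity θ V).NeBot := nhdsLT_neBot_of_exists_lt ⟨0, hzc⟩
  obtain ⟨z, hz, hzlt⟩ := ((hev.filter_mono nhdsWithin_le_nhds).and
    (eventually_mem_nhdsWithin (s := Set.Iio (criticalActivity θ V)))).exists
  have hztop : z ≠ ∞ := ne_top_of_lt hzlt
  lift z to ℝ≥0 using hztop
  exact ⟨z, hzlt, hz.trans_le (ENNReal.sum_le_tsum s)⟩

lemma exists_density_eq (hV : AdmissiblePotential V) (hzc : 0 < criticalActivity θ V) (hρ : 0 < ρ)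
    (h : ENNReal.ofReal ρ < criticalDensity θ V) :
    ∃ z : ℝ≥0, density θ V z = ENNReal.ofReal ρ := by
  obtain ⟨z₁, hz₁, hlt⟩ := exists_density_gt hV hzc h
  have hfin := density_ne_top_of_lt hz₁
  have hs := hasSum_density hV hfin
  set g : ℝ → ℝ := fun z => ∑' j : ℕ+, (j : ℕ) * (pressureCoeff θ V j * z ^ (j : ℕ)) with hg
  have hbound : ∀ z ∈ Set.Icc (0 : ℝ) z₁, ∀ j : ℕ+,
      ‖((j : ℕ) : ℝ) * (pressureCoeff θ V j * z ^ (j : ℕ))‖ ≤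
        (j : ℕ) * (pressureCoeff θ V j * (z₁ : ℝ) ^ (j : ℕ)) := by
    intro z hz j
    have hb := pressureCoeff_nonneg (θ := θ) (V := V) j
    have hz0 := hz.1
    have hz1 := hz.2
    rw [Real.norm_of_nonneg (by positivity)]
    gcongr
  have hgc : ContinuousOn g (Set.Icc 0 z₁) :=
    continuousOn_tsum (fun j => by fun_prop) hs.summable fun j z hz => hbound z hz j
  have hmem : ρ ∈ Set.Icc (g 0) (g z₁) := by
    constructor
    · have : g 0 = 0 := by simp [hg]
      rw [this]
      exact hρ.le
    · rw [hg]
      simp only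
      rw [hs.tsum_eq]
      exact (ENNReal.ofReal_le_iff_le_toReal hfin).1 hlt.le
  obtain ⟨z, hz, hgz⟩ := intermediate_value_Icc z₁.2 hgc hmem
  refine ⟨⟨z, hz.1⟩, ?_⟩
  rw [density_eq_ofReal hV (z := ⟨z, hz.1⟩) (hs.summable.of_norm_bounded (hbound z hz))]
  exact congrArg ENNReal.ofReal hgz

lemma criticalActivity_ne_top (hV : AdmissiblePotential V) {j₁ : ℕ+} (hj₁ : θ j₁ ≠ 0)
    (h : criticalDensity θ V ≤ ENNReal.ofReal ρ) : criticalActivity θ V ≠ ∞ := by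
  intro htop
  rw [criticalDensity, htop] at h
  refine ENNReal.ofReal_ne_top (top_le_iff.1 (le_trans ?_ (le_trans (ENNReal.le_tsum j₁) h)))
  rw [ENNReal.top_pow j₁.ne_zero, ENNReal.mul_top (by exact_mod_cast hj₁),
    ENNReal.top_mul (boltzmannIntegral_pos hV j₁).ne']

lemma existsUnique_isActivityAt (hV : AdmissiblePotential V) (hzc : 0 < criticalActivity θ V)
    (hρ : 0 < ρ) {j₁ : ℕ+} (hj₁ : θ j₁ ≠ 0) : ∃! z : ℝ≥0, IsActivityAt θ V ρ z := by
  rcases lt_or_ge (ENNReal.ofReal ρ) (criticalDensity θ V) with h | h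
  · obtain ⟨z, hz⟩ := exists_density_eq hV hzc hρ h
    refine ⟨z, ⟨fun _ => hz, fun h' => absurd h (not_lt.2 h')⟩, fun z' hz' => ?_⟩
    have hz'' := hz'.1 h
    rcases lt_trichotomy z' z with hlt | heq | hlt
    · have := density_strictMono hV hj₁ hlt (by rw [hz'']; exact ENNReal.ofReal_ne_top)
      rw [hz, hz''] at this
      exact absurd this (lt_irrefl _)
    · exact heq
    · have := density_strictMono hV hj₁ hlt (by rw [hz]; exact ENNReal.ofReal_ne_top)
      rw [hz, hz''] at this
      exact absurd this (lt_irrefl _)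
  · have hne := criticalActivity_ne_top hV hj₁ h
    refine ⟨(criticalActivity θ V).toNNReal, ⟨fun h' => absurd h' (not_lt.2 h), fun _ =>
      ENNReal.coe_toNNReal hne⟩, fun z hz => ?_⟩
    rw [← hz.2 h, ENNReal.toNNReal_coe]

lemma IsActivityAt.pos {z₀ : ℝ≥0} (hz₀ : IsActivityAt θ V ρ z₀) (hzc : 0 < criticalActivity θ V)
    (hρ : 0 < ρ) : 0 < z₀ := by
  rcases lt_or_ge (ENNReal.ofReal ρ) (criticalDensity θ V) with h | h
  · refine pos_iff_ne_zero.2 fun h0 => ?_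
    have := hz₀.1 h
    rw [h0, ENNReal.coe_zero, density_zero] at this
    exact (ENNReal.ofReal_pos.2 hρ).ne this
  · have := hz₀.2 h
    rw [← this] at hzc
    exact_mod_cast hzc

lemma IsActivityAt.density_le {z₀ : ℝ≥0} (hz₀ : IsActivityAt θ V ρ z₀) :
    density θ V z₀ ≤ ENNReal.ofReal ρ := by
  rcases lt_or_ge (ENNReal.ofReal ρ) (criticalDensity θ V) with h | h
  · exact (hz₀.1 h).le
  · rw [hz₀.2 h]
    exact h

lemma IsActivityAt.density_ne_top {z₀ : ℝ≥0} (hz₀ : IsActivityAt θ V ρ z₀) :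
    density θ V z₀ ≠ ∞ :=
  ne_top_of_le_ne_top ENNReal.ofReal_ne_top hz₀.density_le

lemma IsActivityAt.density_eq_or_eq {z₀ : ℝ≥0} (hz₀ : IsActivityAt θ V ρ z₀) :
    density θ V z₀ = ENNReal.ofReal ρ ∨ (z₀ : ℝ≥0∞) = criticalActivity θ V := by
  rcases lt_or_ge (ENNReal.ofReal ρ) (criticalDensity θ V) with h | h
  · exact Or.inl (hz₀.1 h)
  · exact Or.inr (hz₀.2 h)

/-- Below the critical activity the series `∑ θ_j z^j / j` converges: its radius of convergence is
at least that of the density, as the integrals `∫ e^{-jV}` decay subexponentially. -/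
lemma summable_sitePressure (hV : AdmissiblePotential V) {z : ℝ≥0}
    (hz : (z : ℝ≥0∞) < criticalActivity θ V) :
    Summable fun j : ℕ+ => (θ j : ℝ) / (j : ℕ) * (z : ℝ) ^ (j : ℕ) := by
  obtain ⟨z', hzz', hz'⟩ := ENNReal.lt_iff_exists_nnreal_btwn.1 hz
  have hzz : (z : ℝ) < z' := by exact_mod_cast hzz'
  rcases eq_or_lt_of_le z.2 with h0 | h0
  · have h0' : (z : ℝ) = 0 := h0.symm
    simp [h0']
  have h0' : (0 : ℝ) < z := h0
  have hz'0 : (0 : ℝ) < z' := h0'.trans hzz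
  obtain ⟨c, hc0, hc⟩ := exists_le_boltzmannIntegral hV (q := z / z') (by positivity)
    ((div_lt_one hz'0).2 hzz)
  have hs := (hasSum_density hV (density_ne_top_of_lt hz')).summable.mul_left c⁻¹
  refine hs.of_nonneg_of_le (fun j => by positivity) fun j => ?_
  have hI : c * ((z : ℝ) / z') ^ (j : ℕ) ≤ (boltzmannIntegral V j).toReal :=
    (ENNReal.ofReal_le_iff_le_toReal (hV.integral_ne_top j j.pos)).1 (hc j)
  have hj : (1 : ℝ) ≤ (j : ℕ) := by exact_mod_cast j.pos
  rw [← mul_assoc ((j : ℕ) : ℝ), natCast_mul_pressureCoeff]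
  have h1 : (θ j : ℝ) / (j : ℕ) ≤ θ j := div_le_self (by positivity) hj
  calc (θ j : ℝ) / (j : ℕ) * (z : ℝ) ^ (j : ℕ) ≤ θ j * (z : ℝ) ^ (j : ℕ) := by gcongr
    _ = c⁻¹ * (θ j * (c * ((z : ℝ) / z') ^ (j : ℕ)) * (z' : ℝ) ^ (j : ℕ)) := by
        rw [div_pow]
        field_simp
    _ ≤ _ := by gcongr

/-! ### The variational problem for the densities of the parts -/

/-- The pressure `∑_j θ_j / j z^j ∫ e^{-jV}`. -/
noncomputable def pressure (θ : ℕ → ℝ≥0) (V : (Fin d → ℝ) → ℝ≥0∞) (z : ℝ) : ℝ :=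
  ∑' j : ℕ+, pressureCoeff θ V j * z ^ (j : ℕ)

/-- The terms of the pressure are at most those of the density. -/
lemma summable_pressure (hV : AdmissiblePotential V) {z : ℝ≥0} (hz : density θ V z ≠ ∞) :
    Summable fun j : ℕ+ => pressureCoeff θ V j * (z : ℝ) ^ (j : ℕ) := by
  refine (hasSum_density hV hz).summable.of_nonneg_of_le
    (fun j => mul_nonneg (pressureCoeff_nonneg j) (by positivity)) fun j => ?_
  have hj : (1 : ℝ) ≤ (j : ℕ) := by exact_mod_cast j.pos
  exact le_mul_of_one_le_left (mul_nonneg (pressureCoeff_nonneg j) (by positivity)) hj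

lemma poissonRate_self {b z : ℝ} (hb : 0 < b) (hz : 0 < z) (j : ℕ) :
    poissonRate b (b * z ^ j) = b * z ^ j - Real.log z * (j * (b * z ^ j)) := by
  unfold poissonRate Real.negMulLog
  rw [Real.log_mul hb.ne' (by positivity), Real.log_pow]
  ring

/-- At the radius of convergence there are arbitrarily large `j` for which `θ_j ∫ e^{-jV}` is not
exponentially smaller than `z_c^{-j}`. -/
lemma exists_large_part (hV : AdmissiblePotential V) {z₀ : ℝ≥0} (hz₀ : 0 < z₀)
    (hc : (z₀ : ℝ≥0∞) = criticalActivity θ V) {ε : ℝ} (hε : 0 < ε) (J : ℕ) :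
    ∃ j : ℕ+, J ≤ j ∧ θ j ≠ 0 ∧
      -(j : ℕ) * (Real.log z₀ + ε) ≤ Real.log (θ j * (boltzmannIntegral V j).toReal) := by
  by_contra! hcon
  have hz₀' : (0 : ℝ) < z₀ := hz₀
  set z' : ℝ≥0 := z₀ * ⟨Real.exp (ε / 2), (Real.exp_pos _).le⟩ with hz'
  have hz'r : (z' : ℝ) = z₀ * Real.exp (ε / 2) := rfl
  have hlt : z₀ < z' := by
    rw [← NNReal.coe_lt_coe, hz'r]
    exact lt_mul_of_one_lt_right hz₀' (by simpa using hε)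
  have hsum : Summable fun j : ℕ+ =>
      ((j : ℕ) : ℝ) * (pressureCoeff θ V j * (z' : ℝ) ^ (j : ℕ)) := by
    have hgeo : Summable fun j : ℕ+ => Real.exp (-(ε / 2)) ^ (j : ℕ) :=
      (summable_geometric_of_lt_one (Real.exp_nonneg _)
        (by simpa using hε)).comp_injective PNat.coe_injective
    refine Summable.of_norm_bounded_eventually hgeo ?_
    have hfin : {j : ℕ+ | (j : ℕ) < J}.Finite :=
      (Set.finite_lt_nat J).preimage PNat.coe_injective.injOn
    filter_upwards [hfin.compl_mem_cofinite] with j hj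
    have hj' : J ≤ (j : ℕ) := not_lt.1 hj
    rw [Real.norm_of_nonneg (mul_nonneg (Nat.cast_nonneg _)
      (mul_nonneg (pressureCoeff_nonneg j) (by positivity))), ← mul_assoc,
      natCast_mul_pressureCoeff]
    by_cases h0 : θ j = 0
    · rw [h0]
      simp only [NNReal.coe_zero, zero_mul]
      positivity
    · have h := hcon j hj' h0
      have hpos : 0 < (θ j : ℝ) * (boltzmannIntegral V j).toReal :=
        mul_pos (by exact_mod_cast pos_iff_ne_zero.2 h0) (toReal_boltzmannIntegral_pos hV j)
      have hle := ((Real.log_lt_iff_lt_exp hpos).1 h).le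
      calc (θ j : ℝ) * (boltzmannIntegral V j).toReal * (z' : ℝ) ^ (j : ℕ)
          ≤ Real.exp (-(j : ℕ) * (Real.log z₀ + ε)) * (z' : ℝ) ^ (j : ℕ) := by gcongr
        _ = Real.exp (-(ε / 2)) ^ (j : ℕ) := by
          have hexp : (z' : ℝ) = Real.exp (Real.log z₀ + ε / 2) := by
            rw [hz'r, Real.exp_add, Real.exp_log hz₀']
          rw [hexp, ← Real.exp_nat_mul, ← Real.exp_nat_mul, ← Real.exp_add]
          congr 1
          ring
  have hne : density θ V z' ≠ ∞ := by
    rw [density_eq_ofReal hV hsum]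
    exact ENNReal.ofReal_ne_top
  have := le_criticalActivity hne
  rw [← hc] at this
  exact absurd hlt (not_lt.2 (by exact_mod_cast this))

lemma sum_filter_support (hV : AdmissiblePotential V) {z : ℝ} (hz : 0 < z) (s : Finset ℕ+)
    [DecidablePred fun j : ℕ+ => θ j ≠ 0] :
    ∑ j ∈ s.filter fun j : ℕ+ => θ j ≠ 0,
        poissonRate (pressureCoeff θ V j) (pressureCoeff θ V j * z ^ (j : ℕ)) =
      ∑ j ∈ s, pressureCoeff θ V j * z ^ (j : ℕ) -
        Real.log z * ∑ j ∈ s, (j : ℕ) * (pressureCoeff θ V j * z ^ (j : ℕ)) := by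
  rw [Finset.mul_sum, ← Finset.sum_sub_distrib, Finset.sum_filter]
  refine Finset.sum_congr rfl fun j _ => ?_
  split_ifs with h
  · exact poissonRate_self (pressureCoeff_pos hV h) hz j
  · have h0 : θ j = 0 := not_not.1 h
    simp [pressureCoeff, h0]

lemma sum_filter_size (z : ℝ) (s : Finset ℕ+) [DecidablePred fun j : ℕ+ => θ j ≠ 0] :
    ∑ j ∈ s.filter fun j : ℕ+ => θ j ≠ 0, (j : ℕ) * (pressureCoeff θ V j * z ^ (j : ℕ)) =
      ∑ j ∈ s, (j : ℕ) * (pressureCoeff θ V j * z ^ (j : ℕ)) := by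
  refine Finset.sum_filter_of_ne fun j _ hne h0 => hne ?_
  simp [pressureCoeff, h0]

/-- Without condensation, the densities `b_j z₀^j` of finitely many parts, with the small missing
mass put on one fixed part, nearly reach the value `p(z₀) - ρ log z₀`. -/
lemma exists_densities_of_density_eq (hV : AdmissiblePotential V) (hρ : 0 < ρ) {j₁ : ℕ+}
    (hj₁ : θ j₁ ≠ 0) {z₀ : ℝ≥0} (hz₀ : 0 < z₀) (hd : density θ V z₀ = ENNReal.ofReal ρ)
    {η : ℝ} (hη : 0 < η) :
    ∃ (F : Finset ℕ+) (α : ℕ+ → ℝ) (j₀ : ℕ+), (∀ j ∈ F, θ j ≠ 0) ∧ (∀ j ∈ F, 0 ≤ α j) ∧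
      ∑ j ∈ F, (j : ℕ) * α j = ρ ∧ j₀ ∈ F ∧ 0 < α j₀ ∧
      pressure θ V z₀ - ρ * Real.log z₀ - η ≤ ∑ j ∈ F, poissonRate (pressureCoeff θ V j) (α j) := by
  classical
  have hz₀' : (0 : ℝ) < z₀ := hz₀
  have hne : density θ V z₀ ≠ ∞ := by rw [hd]; exact ENNReal.ofReal_ne_top
  have hsum := hasSum_density hV hne
  rw [hd, ENNReal.toReal_ofReal hρ.le] at hsum
  have hp := (summable_pressure hV hne).hasSum
  set g : ℕ+ → ℝ := fun j => pressureCoeff θ V j * (z₀ : ℝ) ^ (j : ℕ) with hg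
  have hg0 : ∀ j, 0 ≤ g j := fun j => mul_nonneg (pressureCoeff_nonneg j) (by positivity)
  have hj₁pos : (0 : ℝ) < (j₁ : ℕ) := by exact_mod_cast j₁.pos
  set δ : Finset ℕ+ → ℝ := fun s => ρ - ∑ j ∈ s, (j : ℕ) * g j with hδ
  have hδlim : Tendsto δ atTop (𝓝 0) := by
    have : Tendsto (fun s : Finset ℕ+ => ∑ j ∈ s, ((j : ℕ) : ℝ) * g j) atTop (𝓝 ρ) := hsum
    simpa using this.const_sub ρ
  have hδ0 : ∀ s, 0 ≤ δ s := fun s => sub_nonneg.2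
    (sum_le_hasSum s (fun j _ => mul_nonneg (Nat.cast_nonneg _) (hg0 j)) hsum)
  set b := pressureCoeff θ V j₁ with hb
  have hlim : Tendsto (fun s : Finset ℕ+ => (∑ j ∈ s, g j - Real.log z₀ * ∑ j ∈ s, (j : ℕ) * g j) +
      (poissonRate b (g j₁ + δ s / (j₁ : ℕ)) - poissonRate b (g j₁))) atTop
      (𝓝 ((pressure θ V z₀ - Real.log z₀ * ρ) +
        (poissonRate b (g j₁ + 0 / (j₁ : ℕ)) - poissonRate b (g j₁)))) := by
    have h1 : Tendsto (fun s : Finset ℕ+ => ∑ j ∈ s, g j) atTop (𝓝 (pressure θ V z₀)) := hp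
    have h2 : Tendsto (fun s : Finset ℕ+ => ∑ j ∈ s, ((j : ℕ) : ℝ) * g j) atTop (𝓝 ρ) := hsum
    refine (h1.sub (h2.const_mul _)).add (Tendsto.sub_const ?_ _)
    exact ((continuous_poissonRate b).tendsto _).comp ((hδlim.div_const _).const_add _)
  have hlt : pressure θ V z₀ - ρ * Real.log z₀ - η < (pressure θ V z₀ - Real.log z₀ * ρ) +
        (poissonRate b (g j₁ + 0 / (j₁ : ℕ)) - poissonRate b (g j₁)) := by
    rw [zero_div, add_zero, sub_self]
    linarith
  obtain ⟨s, hs, hs₁⟩ := ((hlim.eventually (lt_mem_nhds hlt)).and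
    (eventually_ge_atTop {j₁})).exists
  have hj₁s : j₁ ∈ s := hs₁ (Finset.mem_singleton_self _)
  have hj₁F : j₁ ∈ s.filter fun j : ℕ+ => θ j ≠ 0 := Finset.mem_filter.2 ⟨hj₁s, hj₁⟩
  set α : ℕ+ → ℝ := fun j => g j + if j = j₁ then δ s / (j₁ : ℕ) else 0 with hα
  have hα0 : ∀ j, g j ≤ α j := fun j => by
    simp only [hα]
    split_ifs
    · have := div_nonneg (hδ0 s) hj₁pos.le
      linarith
    · linarith
  refine ⟨s.filter fun j : ℕ+ => θ j ≠ 0, α, j₁, fun j hj => (Finset.mem_filter.1 hj).2,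
    fun j _ => (hg0 j).trans (hα0 j), ?_, hj₁F, ?_, ?_⟩
  · simp only [hα, mul_add, Finset.sum_add_distrib]
    rw [sum_filter_size]
    simp only [mul_ite, mul_zero, Finset.sum_ite_eq', hj₁F, if_true]
    rw [mul_div_cancel₀ _ hj₁pos.ne']
    simp [hδ, hg]
  · exact lt_of_lt_of_le (mul_pos (pressureCoeff_pos hV hj₁) (by positivity)) (hα0 j₁)
  · refine hs.le.trans (le_of_eq ?_)
    rw [← sum_filter_support hV hz₀', ← Finset.add_sum_erase _ _ hj₁F,
      ← Finset.add_sum_erase _ (fun j => poissonRate (pressureCoeff θ V j) (α j)) hj₁F]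
    have h1 : ∑ j ∈ (s.filter fun j : ℕ+ => θ j ≠ 0).erase j₁,
          poissonRate (pressureCoeff θ V j) (α j) =
        ∑ j ∈ (s.filter fun j : ℕ+ => θ j ≠ 0).erase j₁,
          poissonRate (pressureCoeff θ V j) (pressureCoeff θ V j * (z₀ : ℝ) ^ (j : ℕ)) :=
      Finset.sum_congr rfl fun j hj => by simp [hα, hg, Finset.ne_of_mem_erase hj]
    rw [h1]
    simp only [hα, if_true, hg, hb]
    ring

/-- In the condensed phase, the missing mass is put on one large part `j₀`; the cost per unit of
mass tends to `log z_c` as `j₀ → ∞`. -/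
lemma exists_densities_of_density_lt (hV : AdmissiblePotential V) (hρ : 0 < ρ)
    {z₀ : ℝ≥0} (hz₀ : 0 < z₀) (hd : density θ V z₀ < ENNReal.ofReal ρ)
    (hc : (z₀ : ℝ≥0∞) = criticalActivity θ V) {η : ℝ} (hη : 0 < η) :
    ∃ (F : Finset ℕ+) (α : ℕ+ → ℝ) (j₀ : ℕ+), (∀ j ∈ F, θ j ≠ 0) ∧ (∀ j ∈ F, 0 ≤ α j) ∧
      ∑ j ∈ F, (j : ℕ) * α j = ρ ∧ j₀ ∈ F ∧ 0 < α j₀ ∧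
      pressure θ V z₀ - ρ * Real.log z₀ - η ≤ ∑ j ∈ F, poissonRate (pressureCoeff θ V j) (α j) := by
  classical
  have hz₀' : (0 : ℝ) < z₀ := hz₀
  have hne : density θ V z₀ ≠ ∞ := ne_top_of_lt hd
  have hsum := hasSum_density hV hne
  have hp := (summable_pressure hV hne).hasSum
  have hdρ : (density θ V z₀).toReal < ρ := (ENNReal.lt_ofReal_iff_toReal_lt hne).1 hd
  set g : ℕ+ → ℝ := fun j => pressureCoeff θ V j * (z₀ : ℝ) ^ (j : ℕ) with hg
  have hg0 : ∀ j, 0 ≤ g j := fun j => mul_nonneg (pressureCoeff_nonneg j) (by positivity)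
  have hpev : ∀ᶠ s : Finset ℕ+ in atTop, pressure θ V z₀ - η / 2 < ∑ j ∈ s, g j :=
    hp.eventually (lt_mem_nhds (sub_lt_self _ (half_pos hη)))
  obtain ⟨s, hs⟩ := hpev.exists
  set δ := ρ - ∑ j ∈ s, (j : ℕ) * g j with hδ
  have hδ0 : 0 < δ := sub_pos.2 (lt_of_le_of_lt
    (sum_le_hasSum s (fun j _ => mul_nonneg (Nat.cast_nonneg _) (hg0 j)) hsum) hdρ)
  have hδρ : δ ≤ ρ := sub_le_self _
    (Finset.sum_nonneg fun j _ => mul_nonneg (Nat.cast_nonneg _) (hg0 j))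
  set ε := η / (4 * ρ) with hε
  have hε0 : 0 < ε := by positivity
  have hερ : 2 * ε * ρ = η / 2 := by
    rw [hε]
    field_simp
    norm_num
  obtain ⟨j₀, hj₀, hθ₀, hlog⟩ := exists_large_part hV hz₀ hc hε0
    (max (s.sup (fun j : ℕ+ => (j : ℕ)) + 1) ⌈|Real.log ρ| / ε⌉₊)
  have hj₀s : j₀ ∉ s := fun h => by
    have h1 := Finset.le_sup (f := fun j : ℕ+ => (j : ℕ)) h
    have h2 := (le_max_left _ _).trans hj₀
    omega
  have hj₀pos : (0 : ℝ) < (j₀ : ℕ) := by exact_mod_cast j₀.pos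
  have hρlog : Real.log ρ ≤ ε * (j₀ : ℕ) := by
    have h1 : |Real.log ρ| / ε ≤ (j₀ : ℕ) :=
      (Nat.le_ceil _).trans (by exact_mod_cast (le_max_right _ _).trans hj₀)
    rw [div_le_iff₀ hε0] at h1
    linarith [le_abs_self (Real.log ρ)]
  have hj₀F : j₀ ∉ s.filter fun j : ℕ+ => θ j ≠ 0 := fun h => hj₀s (Finset.mem_filter.1 h).1
  set α : ℕ+ → ℝ := fun j => if j = j₀ then δ / (j₀ : ℕ) else g j with hα
  have hαF : ∀ j ∈ s.filter fun j : ℕ+ => θ j ≠ 0, α j = g j := fun j hj => by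
    have : j ≠ j₀ := fun h => hj₀F (h ▸ hj)
    simp [hα, this]
  have hα₀ : α j₀ = δ / (j₀ : ℕ) := by simp [hα]
  have hrate : -δ * Real.log z₀ - η / 2 ≤ poissonRate (pressureCoeff θ V j₀) (α j₀) := by
    have hb := pressureCoeff_pos hV hθ₀
    have h1 : poissonRate (pressureCoeff θ V j₀) (α j₀) =
        δ / (j₀ : ℕ) * (Real.log (θ j₀ * (boltzmannIntegral V j₀).toReal) - Real.log δ + 1) := by
      rw [hα₀, ← natCast_mul_pressureCoeff, Real.log_mul hj₀pos.ne' hb.ne', poissonRate,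
        Real.negMulLog, Real.log_div hδ0.ne' hj₀pos.ne']
      ring
    have h2 : Real.log δ ≤ Real.log ρ := Real.log_le_log hδ0 hδρ
    have h3 : -(j₀ : ℕ) * (Real.log z₀ + 2 * ε) ≤
        Real.log (θ j₀ * (boltzmannIntegral V j₀).toReal) - Real.log δ + 1 := by linarith
    have h4 := mul_le_mul_of_nonneg_left h3 (div_pos hδ0 hj₀pos).le
    have h5 : δ / (j₀ : ℕ) * (-(j₀ : ℕ) * (Real.log z₀ + 2 * ε)) =
        -δ * Real.log z₀ - 2 * ε * δ := by
      field_simp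
      ring
    have h6 : 2 * ε * δ ≤ 2 * ε * ρ := by gcongr
    rw [h1]
    linarith
  refine ⟨insert j₀ (s.filter fun j : ℕ+ => θ j ≠ 0), α, j₀, fun j hj => ?_, fun j _ => ?_, ?_,
    Finset.mem_insert_self _ _, ?_, ?_⟩
  · rcases Finset.mem_insert.1 hj with rfl | h
    exacts [hθ₀, (Finset.mem_filter.1 h).2]
  · simp only [hα]
    split_ifs
    exacts [(div_pos hδ0 hj₀pos).le, hg0 j]
  · rw [Finset.sum_insert hj₀F, hα₀, mul_div_cancel₀ _ hj₀pos.ne',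
      Finset.sum_congr rfl fun j hj => by rw [hαF j hj], sum_filter_size, hδ]
    simp [hg]
  · rw [hα₀]
    exact div_pos hδ0 hj₀pos
  · rw [Finset.sum_insert hj₀F,
      Finset.sum_congr (g := fun j => poissonRate (pressureCoeff θ V j)
        (pressureCoeff θ V j * (z₀ : ℝ) ^ (j : ℕ))) rfl fun j hj => by rw [hαF j hj],
      sum_filter_support hV hz₀']
    have : ∑ j ∈ s, ((j : ℕ) : ℝ) * (pressureCoeff θ V j * (z₀ : ℝ) ^ (j : ℕ)) = ρ - δ := by
      rw [hδ]
      ring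
    rw [this]
    have hsg : ∑ j ∈ s, pressureCoeff θ V j * (z₀ : ℝ) ^ (j : ℕ) = ∑ j ∈ s, g j := rfl
    rw [hsg]
    linarith

/-- The lower bound on `Z_{L,n}` with the sharp exponential rate `p(z₀) - ρ log z₀`. -/
lemma eventually_exp_le_partitionFunction (hd : 1 ≤ d) (hρ : 0 < ρ) (hV : AdmissiblePotential V)
    (hzc : 0 < criticalActivity θ V) {j₁ : ℕ+} (hj₁ : θ j₁ ≠ 0) {z₀ : ℝ≥0}
    (hz₀ : IsActivityAt θ V ρ z₀) {η : ℝ} (hη : 0 < η) :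
    ∀ᶠ n : ℕ in thermodynamicLimit θ V ρ,
      ENNReal.ofReal (Real.exp (n / ρ * (pressure θ V z₀ - ρ * Real.log z₀ - η))) ≤
        partitionFunction θ V (lengthAt d ρ n) n := by
  have hpos := hz₀.pos hzc hρ
  obtain ⟨F, α, j₀, hF, hα, hsum, hj₀, hα₀, hle⟩ :
      ∃ (F : Finset ℕ+) (α : ℕ+ → ℝ) (j₀ : ℕ+), (∀ j ∈ F, θ j ≠ 0) ∧ (∀ j ∈ F, 0 ≤ α j) ∧
      ∑ j ∈ F, (j : ℕ) * α j = ρ ∧ j₀ ∈ F ∧ 0 < α j₀ ∧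
      pressure θ V z₀ - ρ * Real.log z₀ - η / 2 ≤
        ∑ j ∈ F, poissonRate (pressureCoeff θ V j) (α j) := by
    rcases hz₀.density_le.eq_or_lt with h | h
    · exact exists_densities_of_density_eq hV hρ hj₁ hpos h (half_pos hη)
    · exact exists_densities_of_density_lt hV hρ hpos h
        (hz₀.density_eq_or_eq.resolve_left h.ne) (half_pos hη)
  filter_upwards [eventually_le_partitionFunction hd hρ hV F hF α hα hsum hj₀ hα₀ (half_pos hη)]
    with n hn
  refine le_trans (ENNReal.ofReal_le_ofReal (Real.exp_le_exp.2 ?_)) hn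
  refine mul_le_mul_of_nonneg_left ?_ (by positivity)
  have : ∑ j ∈ F, poissonRate ((θ j : ℝ) / (j : ℕ) * (boltzmannIntegral V j).toReal) (α j) =
      ∑ j ∈ F, poissonRate (pressureCoeff θ V j) (α j) := rfl
  rw [this]
  linarith

end Activity

/-! ### Exponential moments -/

section Moments

variable {d : ℕ} {θ : ℕ → ℝ≥0} {V : (Fin d → ℝ) → ℝ≥0∞} {ρ : ℝ}

/-- The pressure `∑_j θ_j / j y^j` of one site at local activity `y`. -/
noncomputable def sitePressure (θ : ℕ → ℝ≥0) (y : ℝ) : ℝ :=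
  ∑' j : ℕ+, (θ j : ℝ) / (j : ℕ) * y ^ (j : ℕ)

lemma summable_sitePressure_mul (hV : AdmissiblePotential V) {z : ℝ≥0}
    (hz : (z : ℝ≥0∞) < criticalActivity θ V) {u : ℝ} (hu : u ∈ Set.Icc (0 : ℝ) 1) :
    Summable fun j : ℕ+ => (θ j : ℝ) / (j : ℕ) * (z * u) ^ (j : ℕ) := by
  have hu0 := hu.1
  refine (summable_sitePressure hV hz).of_nonneg_of_le (fun j => by positivity) fun j => ?_
  gcongr
  exact mul_le_of_le_one_right z.2 hu.2

/-- The tilt `e^{t s_j}` multiplies the coefficient of the part `j` by `e^t`. -/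
lemma tsum_exp_mul_siteWeight_le {y : ℝ} (hy : 0 ≤ y)
    (hs : Summable fun j : ℕ+ => (θ j : ℝ) / (j : ℕ) * y ^ (j : ℕ)) (j : ℕ+) (t : ℝ) :
    ∑' s : ℕ+ →₀ ℕ, ENNReal.ofReal (Real.exp (t * (s j : ℕ))) * siteWeight θ (ENNReal.ofReal y) s ≤
      ENNReal.ofReal (Real.exp (sitePressure θ y +
        (Real.exp t - 1) * ((θ j : ℝ) / (j : ℕ) * y ^ (j : ℕ)))) := by
  classical
  set q : ℕ+ → ℝ := fun i => (θ i : ℝ) / (i : ℕ) * y ^ (i : ℕ) with hq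
  set q' : ℕ+ → ℝ := fun i => q i * if i = j then Real.exp t else 1 with hq'
  have hq0 : ∀ i, 0 ≤ q i := fun i => by positivity
  have hq'0 : ∀ i, 0 ≤ q' i := fun i => mul_nonneg (hq0 i) (by split_ifs <;> positivity)
  have hsum : HasSum q' (sitePressure θ y + (Real.exp t - 1) * q j) := by
    refine (hs.hasSum.add (hasSum_ite_eq j ((Real.exp t - 1) * q j))).congr_fun ?_
    intro i
    simp only [hq']
    split_ifs with h
    · subst h
      simp only [hq]
      ring
    · simp [hq]
  have hterm : ∀ s : ℕ+ →₀ ℕ, ENNReal.ofReal (Real.exp (t * (s j : ℕ))) *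
      siteWeight θ (ENNReal.ofReal y) s =
      s.prod (fun i m => ((m ! : ℕ) : ℝ≥0∞)⁻¹ * ENNReal.ofReal (q' i) ^ m) := by
    intro s
    have h1 : ENNReal.ofReal (Real.exp (t * (s j : ℕ))) =
        s.prod fun i m => ENNReal.ofReal (if i = j then Real.exp t else 1) ^ m := by
      rw [mul_comm, Real.exp_nat_mul, ENNReal.ofReal_pow (Real.exp_nonneg _)]
      by_cases hj : j ∈ s.support
      · rw [Finsupp.prod, Finset.prod_eq_single_of_mem j hj fun i _ hi => by simp [hi]]
        simp
      · rw [Finsupp.notMem_support_iff.1 hj, pow_zero, Finsupp.prod]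
        refine (Finset.prod_eq_one fun i hi => ?_).symm
        have : i ≠ j := fun h => hj (h ▸ hi)
        simp [this]
    rw [h1, siteWeight, ← Finsupp.prod_mul]
    refine Finsupp.prod_congr fun i _ => ?_
    have h2 : ENNReal.ofReal (q' i) = (θ i : ℝ≥0∞) / ((i : ℕ) : ℝ≥0∞) *
        ENNReal.ofReal y ^ (i : ℕ) * ENNReal.ofReal (if i = j then Real.exp t else 1) := by
      rw [ENNReal.ofReal_mul (hq0 i), ENNReal.ofReal_mul (by positivity), ENNReal.ofReal_pow hy,
        ENNReal.ofReal_div_of_pos (by exact_mod_cast i.pos), ENNReal.ofReal_coe_nnreal,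
        ENNReal.ofReal_natCast]
    rw [h2, mul_pow _ (ENNReal.ofReal (if i = j then Real.exp t else 1))]
    ring
  rw [tsum_congr hterm, ← hsum.tsum_eq]
  exact tsum_prod_inv_factorial_le q' hq'0 hsum.summable

lemma tsum_siteWeight_le {y : ℝ} (hy : 0 ≤ y)
    (hs : Summable fun j : ℕ+ => (θ j : ℝ) / (j : ℕ) * y ^ (j : ℕ)) :
    ∑' s : ℕ+ →₀ ℕ, siteWeight θ (ENNReal.ofReal y) s ≤
      ENNReal.ofReal (Real.exp (sitePressure θ y)) := by
  simpa using tsum_exp_mul_siteWeight_le hy hs 1 0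

/-- The quotient `∑_j θ_j / j z^j u^{j-1}` of the pressure of a site by its Boltzmann factor. -/
noncomputable def reducedPressure (θ : ℕ → ℝ≥0) (z u : ℝ) : ℝ :=
  ∑' j : ℕ+, (θ j : ℝ) / (j : ℕ) * z ^ (j : ℕ) * u ^ ((j : ℕ) - 1)

lemma mul_reducedPressure (z u : ℝ) : u * reducedPressure θ z u = sitePressure θ (z * u) := by
  rw [reducedPressure, sitePressure, ← tsum_mul_left]
  refine tsum_congr fun j => ?_
  rw [mul_left_comm, ← pow_succ', Nat.sub_add_cancel j.pos, mul_pow, mul_assoc]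

lemma continuousOn_reducedPressure (hV : AdmissiblePotential V) {z : ℝ≥0}
    (hz : (z : ℝ≥0∞) < criticalActivity θ V) :
    ContinuousOn (reducedPressure θ z) (Set.Icc 0 1) := by
  refine continuousOn_tsum (fun j => by fun_prop) (summable_sitePressure hV hz) fun j u hu => ?_
  have hu0 := hu.1
  rw [Real.norm_of_nonneg (by positivity)]
  exact mul_le_of_le_one_right (by positivity) (pow_le_one₀ hu0 hu.2)

lemma integral_sitePressure (hV : AdmissiblePotential V) {z : ℝ≥0}
    (hz : (z : ℝ≥0∞) < criticalActivity θ V) :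
    ∫ x, sitePressure θ (z * boltzmannFactor (V x)) = pressure θ V z := by
  have hint : ∀ j : ℕ+, Integrable fun x =>
      (θ j : ℝ) / (j : ℕ) * (z * boltzmannFactor (V x)) ^ (j : ℕ) := fun j => by
    simp only [mul_pow, ← mul_assoc]
    exact (hV.integrable_pow j.pos).const_mul _
  have hval : ∀ j : ℕ+, ∫ x, (θ j : ℝ) / (j : ℕ) * (z * boltzmannFactor (V x)) ^ (j : ℕ) =
      pressureCoeff θ V j * (z : ℝ) ^ (j : ℕ) := fun j => by
    simp only [mul_pow, ← mul_assoc]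
    rw [integral_const_mul, hV.integral_pow, pressureCoeff]
    ring
  have hnorm : Summable fun j : ℕ+ =>
      ∫ x, ‖(θ j : ℝ) / (j : ℕ) * (z * boltzmannFactor (V x)) ^ (j : ℕ)‖ := by
    refine (summable_pressure hV (density_ne_top_of_lt hz)).congr fun j => ?_
    rw [← hval]
    refine integral_congr_ae (ae_of_all _ fun x => ?_)
    have := (boltzmannFactor_mem_Icc (V x)).1
    exact (Real.norm_of_nonneg (by positivity)).symm
  have h := (hasSum_integral_of_summable_integral_norm hint hnorm).tsum_eq
  simp only [hval] at h
  exact h.symm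

/-- The sum over the sites of an observable `y` of the partition at a site. -/
noncomputable def siteTotal {n : ℕ} (y : (ℕ+ →₀ ℕ) → ℕ) (lam : SpatialPartition d n) : ℕ :=
  lam.1.sum fun _ s => y s

/-- The upper bound on the exponential moments of an additive observable: the bound for one site is
a function of the Boltzmann factor of the site, and the sum over the sites is a Riemann sum. -/
lemma eventually_moment_le (hd : 1 ≤ d) (hρ : 0 < ρ) (hV : AdmissiblePotential V) {z : ℝ≥0}
    (hz : (z : ℝ≥0∞) < criticalActivity θ V) (y : (ℕ+ →₀ ℕ) → ℕ) (hy : y 0 = 0)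
    {ψ : ℝ → ℝ} (hψ : ContinuousOn ψ (Set.Icc 0 1)) (t : ℝ)
    (hbound : ∀ u ∈ Set.Icc (0 : ℝ) 1, ∑' s : ℕ+ →₀ ℕ,
      ENNReal.ofReal (Real.exp (t * (y s : ℕ))) * siteWeight θ (ENNReal.ofReal (z * u)) s ≤
        ENNReal.ofReal (Real.exp (sitePressure θ (z * u) + (Real.exp t - 1) * (u * ψ u))))
    {η : ℝ} (hη : 0 < η) :
    ∀ᶠ n : ℕ in atTop, (z : ℝ≥0∞) ^ n * ∑' lam : SpatialPartition d n,
        ENNReal.ofReal (Real.exp (t * (siteTotal y lam : ℕ))) *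
          lam.weight θ V (lengthAt d ρ n) ≤
      ENNReal.ofReal (Real.exp (n / ρ * (pressure θ V z + (Real.exp t - 1) *
        (∫ x, boltzmannFactor (V x) * ψ (boltzmannFactor (V x))) + η))) := by
  set c : ℝ → ℝ := fun u => reducedPressure θ z u + (Real.exp t - 1) * ψ u with hc
  have hcc : ContinuousOn c (Set.Icc 0 1) :=
    (continuousOn_reducedPressure hV hz).add (hψ.const_smul (Real.exp t - 1))
  have hcu : ∀ u, u * c u = sitePressure θ (z * u) + (Real.exp t - 1) * (u * ψ u) := fun u => by
    rw [hc, ← mul_reducedPressure]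
    ring
  have hbound' : ∀ u ∈ Set.Icc (0 : ℝ) 1, ∑' s : ℕ+ →₀ ℕ,
      ENNReal.ofReal (Real.exp (t * (y s : ℕ))) * siteWeight θ (ENNReal.ofReal (z * u)) s ≤
        ENNReal.ofReal (Real.exp (u * c u)) := fun u hu => by
    rw [hcu]
    exact hbound u hu
  -- The empty partition contributes `1` to the sum over the partitions at a site.
  have hc0 : ∀ u ∈ Set.Icc (0 : ℝ) 1, 0 ≤ u * c u := fun u hu => by
    have h1 := (ENNReal.le_tsum (0 : ℕ+ →₀ ℕ)).trans (hbound' u hu)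
    rw [siteWeight_zero_right, hy, Nat.cast_zero, mul_zero, Real.exp_zero, ENNReal.ofReal_one,
      mul_one, ENNReal.one_le_ofReal] at h1
    exact Real.one_le_exp_iff.1 h1
  obtain ⟨C, hC⟩ := isCompact_Icc.exists_bound_of_continuousOn hcc
  have hint : ∫ x, boltzmannFactor (V x) * c (boltzmannFactor (V x)) =
      pressure θ V z + (Real.exp t - 1) *
        ∫ x, boltzmannFactor (V x) * ψ (boltzmannFactor (V x)) := by
    simp only [hcu]
    have hi : ∀ f : ℝ → ℝ, ContinuousOn f (Set.Icc 0 1) →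
        Integrable fun x => boltzmannFactor (V x) * f (boltzmannFactor (V x)) := by
      intro f hf
      refine (hV.integrable_mul (hf.domRestrict.Icc_extend' (h := zero_le_one))).congr
        (ae_of_all _ fun x => ?_)
      simp only
      rw [Set.IccExtend_of_mem _ _ (boltzmannFactor_mem_Icc _), Set.domRestrict_apply]
    have h1 := hi _ (continuousOn_reducedPressure hV hz)
    simp only [mul_reducedPressure] at h1
    rw [integral_add h1 ((hi ψ hψ).const_mul _), integral_const_mul, integral_sitePressure hV hz]
  have hlim := tendsto_riemannSum hd hρ hV hcc
  rw [hint] at hlim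
  filter_upwards [hlim.eventually (gt_mem_nhds (lt_add_of_pos_right _ hη)),
    eventually_summable_siteFactor hd hρ hV, eventually_gt_atTop 0] with n hn hs hn0
  have hN0 : (0 : ℝ) < n / ρ := by positivity
  rw [div_lt_iff₀ hN0] at hn
  have hexp : ∀ lam : SpatialPartition d n, ENNReal.ofReal (Real.exp (t * (siteTotal y lam : ℕ))) =
      lam.1.prod fun _ s => ENNReal.ofReal (Real.exp (t * (y s : ℕ))) := by
    intro lam
    rw [Finsupp.prod, ← ENNReal.ofReal_prod_of_nonneg fun _ _ => Real.exp_nonneg _,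
      ← Real.exp_sum, ← Finset.mul_sum, siteTotal, Finsupp.sum, Nat.cast_sum]
  simp only [hexp]
  refine pow_mul_tsum_tilt_le θ V _ z _ _ (by simp [hy]) fun A => ?_
  calc _ ≤ ∏ x ∈ A, ENNReal.ofReal (Real.exp (siteFactor V ρ n x * c (siteFactor V ρ n x))) := by
        refine Finset.prod_le_prod' fun x _ => ?_
        refine le_trans (le_of_eq ?_) (hbound' _ (siteFactor_mem_Icc V ρ n x))
        rw [ENNReal.ofReal_mul z.coe_nonneg, siteFactor, ofReal_boltzmannFactor, ENNReal.ofReal_coe_nnreal]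
    _ = ENNReal.ofReal (Real.exp (∑ x ∈ A, siteFactor V ρ n x * c (siteFactor V ρ n x))) := by
        rw [← ENNReal.ofReal_prod_of_nonneg fun _ _ => Real.exp_nonneg _, ← Real.exp_sum]
    _ ≤ _ := by
        refine ENNReal.ofReal_le_ofReal (Real.exp_le_exp.2 ?_)
        refine ((hs.siteFactor_mul hC).sum_le_tsum A fun x _ =>
          hc0 _ (siteFactor_mem_Icc V ρ n x)).trans ?_
        rw [mul_comm]
        exact hn.le

/-! ### The canonical measure and concentration -/

/-- Markov's inequality for the canonical measure. -/
lemma canonicalMeasure_apply_le {n : ℕ} (L : ℝ) (S : Set (SpatialPartition d n))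
    (f : SpatialPartition d n → ℝ≥0∞) (hf : ∀ lam ∈ S, 1 ≤ f lam) :
    canonicalMeasure θ V L n S ≤
      (∑' lam : SpatialPartition d n, f lam * lam.weight θ V L) / partitionFunction θ V L n := by
  rw [canonicalMeasure, Measure.sum_apply _ (MeasurableSpace.measurableSet_top),
    div_eq_mul_inv, ← ENNReal.tsum_mul_right]
  refine ENNReal.tsum_le_tsum fun lam => ?_
  rw [Measure.smul_apply, Measure.dirac_apply' _ (MeasurableSpace.measurableSet_top), smul_eq_mul,
    div_eq_mul_inv]
  by_cases h : lam ∈ S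
  · rw [Set.indicator_of_mem h, Pi.one_apply, mul_one, mul_assoc]
    exact le_mul_of_one_le_left zero_le (hf lam h)
  · rw [Set.indicator_of_notMem h, mul_zero]
    exact zero_le

lemma isProbabilityMeasure_canonicalMeasure {n : ℕ} {L : ℝ} (h0 : partitionFunction θ V L n ≠ 0)
    (h1 : partitionFunction θ V L n ≠ ∞) : IsProbabilityMeasure (canonicalMeasure θ V L n) := by
  constructor
  rw [canonicalMeasure, Measure.sum_apply _ MeasurableSet.univ]
  simp only [Measure.smul_apply, measure_univ, smul_eq_mul, mul_one, div_eq_mul_inv]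
  rw [ENNReal.tsum_mul_right]
  exact ENNReal.mul_inv_cancel h0 h1

lemma eventually_partitionFunction_ne_top (hd : 1 ≤ d) (hρ : 0 < ρ) (hV : AdmissiblePotential V)
    (hzc : 0 < criticalActivity θ V) :
    ∀ᶠ n : ℕ in atTop, partitionFunction θ V (lengthAt d ρ n) n ≠ ∞ := by
  obtain ⟨z, hz0, hz⟩ := ENNReal.lt_iff_exists_nnreal_btwn.1 hzc
  have h := eventually_moment_le hd hρ hV hz (fun _ => 0) rfl (ψ := fun _ => 0)
    continuousOn_const 0 (fun u hu => by
      simpa using tsum_siteWeight_le (mul_nonneg z.2 hu.1) (summable_sitePressure_mul hV hz hu))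
    one_pos
  filter_upwards [h] with n hn htop
  have hz0' : (z : ℝ≥0∞) ^ n ≠ 0 := pow_ne_zero _ hz0.ne'
  simp only [zero_mul, Real.exp_zero, ENNReal.ofReal_one, one_mul] at hn
  have htop' : ∑' lam : SpatialPartition d n, lam.weight θ V (lengthAt d ρ n) = ∞ := htop
  rw [htop', ENNReal.mul_top hz0'] at hn
  exact ENNReal.ofReal_ne_top (top_le_iff.1 hn)

lemma thermodynamicLimit_neBot (hV0 : V 0 = 0) {j₁ : ℕ+} (hj₁ : θ j₁ ≠ 0) :
    (thermodynamicLimit θ V ρ).NeBot := by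
  rw [thermodynamicLimit, ← frequently_mem_iff_neBot, frequently_atTop]
  intro N
  have hmem : (j₁ : ℕ) ∈ {j : ℕ | 1 ≤ j ∧ θ j ≠ 0} := ⟨j₁.pos, hj₁⟩
  refine ⟨N • (j₁ : ℕ), Nat.le_mul_of_pos_right _ j₁.pos, ?_⟩
  exact partitionFunction_ne_zero hV0 _
    (AddSubmonoid.nsmul_mem _ (AddSubmonoid.subset_closure hmem) N)

/-- The Chernoff bound for one of the two tails (according to the sign of `t`), at an activity `z`
slightly below `z₀`. -/
lemma eventually_tail_le (hd : 1 ≤ d) (hρ : 0 < ρ) (hV : AdmissiblePotential V)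
    (hzc : 0 < criticalActivity θ V) {j₁ : ℕ+} (hj₁ : θ j₁ ≠ 0) {z₀ : ℝ≥0}
    (hz₀ : IsActivityAt θ V ρ z₀) {z : ℝ≥0} (hz0 : 0 < z) (hz : z < z₀) (y : (ℕ+ →₀ ℕ) → ℕ)
    (hy : y 0 = 0) {ψ : ℝ → ℝ} (hψ : ContinuousOn ψ (Set.Icc 0 1)) (t : ℝ)
    (hbound : ∀ u ∈ Set.Icc (0 : ℝ) 1, ∑' s : ℕ+ →₀ ℕ,
      ENNReal.ofReal (Real.exp (t * (y s : ℕ))) * siteWeight θ (ENNReal.ofReal (z * u)) s ≤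
        ENNReal.ofReal (Real.exp (sitePressure θ (z * u) + (Real.exp t - 1) * (u * ψ u))))
    (b : ℝ) {γ : ℝ} (hγ : 0 < γ)
    (hle : (Real.exp t - 1) * (∫ x, boltzmannFactor (V x) * ψ (boltzmannFactor (V x))) - b +
      ρ * (Real.log z₀ - Real.log z) + 3 * γ ≤ 0) :
    ∀ᶠ n : ℕ in thermodynamicLimit θ V ρ, canonicalMeasure θ V (lengthAt d ρ n) n
      {lam | b * (n / ρ) < t * (siteTotal y lam : ℕ)} ≤
        ENNReal.ofReal (Real.exp (-(γ * (n / ρ)))) := by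
  have hzcr : (z : ℝ≥0∞) < criticalActivity θ V :=
    lt_of_lt_of_le (by exact_mod_cast hz) (le_criticalActivity hz₀.density_ne_top)
  have hle' : thermodynamicLimit θ V ρ ≤ atTop := inf_le_left
  have hz0' : (0 : ℝ) < z := hz0
  filter_upwards [(eventually_moment_le hd hρ hV hzcr y hy hψ t hbound hγ).filter_mono hle',
    eventually_exp_le_partitionFunction hd hρ hV hzc hj₁ hz₀ hγ,
    (eventually_gt_atTop 0).filter_mono hle'] with n hU hL hn0
  set a := ∫ x, boltzmannFactor (V x) * ψ (boltzmannFactor (V x)) with ha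
  set M := ∑' lam : SpatialPartition d n, ENNReal.ofReal (Real.exp (t * (siteTotal y lam : ℕ))) *
    lam.weight θ V (lengthAt d ρ n) with hM
  have hN0 : (0 : ℝ) < n / ρ := by positivity
  have hMle : M ≤ ENNReal.ofReal (Real.exp (n / ρ * (pressure θ V z + (Real.exp t - 1) * a + γ)
      - n * Real.log z)) := by
    have hzn : (z : ℝ≥0∞) ^ n = ENNReal.ofReal (Real.exp (n * Real.log z)) := by
      rw [Real.exp_nat_mul, Real.exp_log hz0', ENNReal.ofReal_pow z.coe_nonneg, ENNReal.ofReal_coe_nnreal]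
    rw [hzn] at hU
    have h1 := mul_le_mul_right hU (ENNReal.ofReal (Real.exp (-(n * Real.log z))))
    rw [← mul_assoc, ← ENNReal.ofReal_mul (Real.exp_nonneg _), ← Real.exp_add, neg_add_cancel,
      Real.exp_zero, ENNReal.ofReal_one, one_mul, ← ENNReal.ofReal_mul (Real.exp_nonneg _),
      ← Real.exp_add] at h1
    refine h1.trans (le_of_eq ?_)
    congr 2
    ring
  have hp : pressure θ V z ≤ pressure θ V z₀ := by
    refine (summable_pressure hV (density_ne_top_of_lt hzcr)).tsum_le_tsum (fun j => ?_)
      (summable_pressure hV hz₀.density_ne_top)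
    have := pressureCoeff_nonneg (θ := θ) (V := V) j
    have hzz : (z : ℝ) ≤ z₀ := by exact_mod_cast hz.le
    gcongr
  refine (canonicalMeasure_apply_le (lengthAt d ρ n) _ (fun lam =>
    ENNReal.ofReal (Real.exp (-(b * (n / ρ)))) *
      ENNReal.ofReal (Real.exp (t * (siteTotal y lam : ℕ)))) fun lam hlam => ?_).trans ?_
  · rw [← ENNReal.ofReal_mul (Real.exp_nonneg _), ← Real.exp_add, ENNReal.one_le_ofReal,
      Real.one_le_exp_iff]
    have : b * (n / ρ) < t * (siteTotal y lam : ℕ) := hlam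
    linarith
  · simp only [mul_assoc]
    rw [ENNReal.tsum_mul_left]
    refine ENNReal.div_le_of_le_mul (le_trans (mul_le_mul_right hMle _) ?_)
    refine le_trans ?_ (mul_le_mul_right hL _)
    rw [← ENNReal.ofReal_mul (Real.exp_nonneg _), ← ENNReal.ofReal_mul (Real.exp_nonneg _),
      ← Real.exp_add, ← Real.exp_add]
    refine ENNReal.ofReal_le_ofReal (Real.exp_le_exp.2 ?_)
    have hnρ : (n : ℝ) = n / ρ * ρ := by field_simp
    have h1 : (n : ℝ) * Real.log z = n / ρ * (ρ * Real.log z) := by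
      rw [← mul_assoc, ← hnρ]
    rw [h1]
    nlinarith

/-- Concentration of an additive observable whose exponential moments at one site are controlled,
at activities slightly below `z₀`, by densities `ψ` of mean tending to `a`. -/
lemma tendstoInProbability_of_site_bound (hd : 1 ≤ d) (hρ : 0 < ρ) (hV : AdmissiblePotential V)
    (hzc : 0 < criticalActivity θ V) {j₁ : ℕ+} (hj₁ : θ j₁ ≠ 0) {z₀ : ℝ≥0}
    (hz₀ : IsActivityAt θ V ρ z₀) {ζ : ℕ → ℝ≥0} (hζ0 : ∀ i, 0 < ζ i) (hζ : ∀ i, ζ i < z₀)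
    (hζlim : Tendsto ζ atTop (𝓝 z₀)) (y : (ℕ+ →₀ ℕ) → ℕ)
    (hy : y 0 = 0) {ψ : ℕ → ℝ → ℝ} (hψ : ∀ i, ContinuousOn (ψ i) (Set.Icc 0 1))
    (hbound : ∀ i t, ∀ u ∈ Set.Icc (0 : ℝ) 1, ∑' s : ℕ+ →₀ ℕ,
      ENNReal.ofReal (Real.exp (t * (y s : ℕ))) * siteWeight θ (ENNReal.ofReal (ζ i * u)) s ≤
        ENNReal.ofReal (Real.exp (sitePressure θ (ζ i * u) + (Real.exp t - 1) * (u * ψ i u))))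
    {a : ℝ} (ha : Tendsto (fun i => ∫ x, boltzmannFactor (V x) * ψ i (boltzmannFactor (V x)))
      atTop (𝓝 a)) {k : ℕ} (hk : 1 ≤ k) {A : ℝ≥0∞} (hA : A ≠ ∞) (hA' : A.toReal = k * a / ρ)
    (X : ∀ n : ℕ, SpatialPartition d n → ℝ)
    (hX : ∀ n lam, X n lam = k * (siteTotal y lam : ℕ) / n) :
    TendstoInProbability θ V ρ X A := by
  refine ⟨hA, fun ε hε => ?_⟩
  have hk0 : (0 : ℝ) < k := by exact_mod_cast hk
  set ε' := ε * ρ / k with hε'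
  have hε'0 : 0 < ε' := by positivity
  set τ := min 1 (ε' / (2 * (|a| + 1))) with hτ
  have hτ0 : 0 < τ := lt_min one_pos (by positivity)
  have hτ1 : τ ≤ 1 := min_le_left _ _
  have hτa : |a| * τ ≤ ε' / 2 := by
    have h1 : τ ≤ ε' / (2 * (|a| + 1)) := min_le_right _ _
    rw [le_div_iff₀ (by positivity)] at h1
    nlinarith [abs_nonneg a]
  set γ := τ * ε' / 16 with hγ
  have hγ0 : 0 < γ := by positivity
  -- An activity close enough to `z₀`.
  have hz₀pos := hz₀.pos hzc hρ
  have hz₀pos' : (0 : ℝ) < z₀ := hz₀pos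
  have hlog : Tendsto (fun i => ρ * (Real.log z₀ - Real.log (ζ i))) atTop (𝓝 0) := by
    have h1 : Tendsto (fun i => ((ζ i : ℝ≥0) : ℝ)) atTop (𝓝 (z₀ : ℝ)) :=
      (NNReal.continuous_coe.tendsto _).comp hζlim
    have h2 := (h1.log hz₀pos'.ne').const_sub (Real.log z₀) |>.const_mul ρ
    simpa using h2
  obtain ⟨i, hi1, hi2⟩ := ((hlog.eventually (gt_mem_nhds hγ0)).and
    (Metric.tendsto_nhds.1 ha γ hγ0)).exists
  rw [Real.dist_eq] at hi2
  set ai := ∫ x, boltzmannFactor (V x) * ψ i (boltzmannFactor (V x)) with hai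
  have hexponent : ∀ t : ℝ, |t| = τ → (Real.exp t - 1) * ai - (t * a + τ * ε') +
      ρ * (Real.log z₀ - Real.log (ζ i)) + 3 * γ ≤ 0 := by
    intro t ht
    have h1 := Real.abs_exp_sub_one_sub_id_le (x := t) (ht.le.trans hτ1)
    have ht2 : t ^ 2 = τ * τ := by rw [← sq_abs, ht, sq]
    rw [ht2] at h1
    have h2 : |(Real.exp t - 1 - t) * a| ≤ τ * τ * |a| := by
      rw [abs_mul]
      gcongr
    have h3 : |Real.exp t - 1| ≤ 2 := by
      have : Real.exp t - 1 = (Real.exp t - 1 - t) + t := by ring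
      rw [this]
      refine (abs_add_le _ _).trans ?_
      nlinarith
    have h4 : |(Real.exp t - 1) * (ai - a)| ≤ 2 * γ := by
      rw [abs_mul]
      exact mul_le_mul h3 hi2.le (abs_nonneg _) (by norm_num)
    have h5 : τ * τ * |a| ≤ τ * ε' / 2 := by
      have := mul_le_mul_of_nonneg_left hτa hτ0.le
      linarith
    have h6 := (le_abs_self _).trans h2
    have h7 := (le_abs_self _).trans h4
    have h8 : γ * 16 = τ * ε' := by rw [hγ]; ring
    nlinarith
  have htail : ∀ t : ℝ, |t| = τ → ∀ᶠ n : ℕ in thermodynamicLimit θ V ρ,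
      canonicalMeasure θ V (lengthAt d ρ n) n
        {lam | (t * a + τ * ε') * (n / ρ) < t * (siteTotal y lam : ℕ)} ≤
          ENNReal.ofReal (Real.exp (-(γ * (n / ρ)))) := fun t ht =>
    eventually_tail_le hd hρ hV hzc hj₁ hz₀ (hζ0 i) (hζ i) y hy (hψ i) t (hbound i t) _ hγ0
      (hexponent t ht)
  have hle' : thermodynamicLimit θ V ρ ≤ atTop := inf_le_left
  have hzero : Tendsto (fun n : ℕ => 2 * ENNReal.ofReal (Real.exp (-(γ * (n / ρ)))))
      (thermodynamicLimit θ V ρ) (𝓝 0) := by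
    have h1 : Tendsto (fun n : ℕ => Real.exp (-(γ * ((n : ℝ) / ρ)))) atTop (𝓝 0) :=
      Real.tendsto_exp_neg_atTop_nhds_zero.comp
        ((tendsto_natCast_div_atTop hρ).const_mul_atTop hγ0)
    have h2 := ENNReal.Tendsto.const_mul (a := 2) (ENNReal.tendsto_ofReal h1)
      (Or.inr ENNReal.ofNat_ne_top)
    rw [ENNReal.ofReal_zero, mul_zero] at h2
    exact h2.mono_left hle'
  refine tendsto_of_tendsto_of_tendsto_of_le_of_le' tendsto_const_nhds hzero
    (Eventually.of_forall fun _ => zero_le) ?_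
  filter_upwards [htail τ (abs_of_pos hτ0), htail (-τ) (by rw [abs_neg, abs_of_pos hτ0]),
    (eventually_gt_atTop 0).filter_mono hle'] with n h1 h2 hn0
  rw [two_mul]
  refine le_trans (measure_mono ?_) ((measure_union_le _ _).trans (add_le_add h1 h2))
  intro lam hlam
  have hn : (0 : ℝ) < n := by exact_mod_cast hn0
  have hlam' : ε < |X n lam - A.toReal| := hlam
  have heq : X n lam - A.toReal = (k / n) * ((siteTotal y lam : ℕ) - a * (n / ρ)) := by
    rw [hX, hA']
    field_simp
  rw [heq, abs_mul, abs_of_pos (by positivity), div_mul_eq_mul_div, lt_div_iff₀ hn] at hlam'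
  have h3 : ε' * (n / ρ) < |((siteTotal y lam : ℕ) : ℝ) - a * (n / ρ)| := by
    have : ε' * (n / ρ) = ε * n / k := by
      rw [hε']
      field_simp
    rw [this, div_lt_iff₀ hk0]
    linarith
  rcases lt_abs.1 h3 with h | h
  · left
    change (τ * a + τ * ε') * (n / ρ) < τ * (siteTotal y lam : ℕ)
    have := mul_lt_mul_of_pos_left h hτ0
    linarith
  · right
    change (-τ * a + τ * ε') * (n / ρ) < -τ * (siteTotal y lam : ℕ)
    have := mul_lt_mul_of_pos_left h hτ0
    linarith

end Moments

/-! ### The numbers of parts of a given size -/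

section Limits

variable {d : ℕ} {θ : ℕ → ℝ≥0} {V : (Fin d → ℝ) → ℝ≥0∞} {ρ : ℝ}

lemma tendstoInProbability_parts (hd : 1 ≤ d) (hρ : 0 < ρ) (hV : AdmissiblePotential V)
    (hzc : 0 < criticalActivity θ V) {j₁ : ℕ+} (hj₁ : θ j₁ ≠ 0) {z₀ : ℝ≥0}
    (hz₀ : IsActivityAt θ V ρ z₀) (j : ℕ+) :
    TendstoInProbability θ V ρ (fun n lam => ((j : ℕ) : ℝ) * (lam.R j : ℝ) / (n : ℝ))
      ((θ j : ℝ≥0∞) * (z₀ : ℝ≥0∞) ^ (j : ℕ) * boltzmannIntegral V j / ENNReal.ofReal ρ) := by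
  obtain ⟨ζ, -, hζ, hζlim⟩ := exists_seq_strictMono_tendsto' (hz₀.pos hzc hρ)
  have hζc : ∀ i, (ζ i : ℝ≥0∞) < criticalActivity θ V := fun i =>
    lt_of_lt_of_le (by exact_mod_cast (hζ i).2) (le_criticalActivity hz₀.density_ne_top)
  have hmul : ∀ (z u : ℝ), u * ((θ j : ℝ) / (j : ℕ) * z ^ (j : ℕ) * u ^ ((j : ℕ) - 1)) =
      (θ j : ℝ) / (j : ℕ) * (z * u) ^ (j : ℕ) := fun z u => by
    rw [mul_left_comm, ← pow_succ', Nat.sub_add_cancel j.pos, mul_pow, mul_assoc]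
  refine tendstoInProbability_of_site_bound hd hρ hV hzc hj₁ hz₀ (fun i => (hζ i).1)
    (fun i => (hζ i).2) hζlim (fun s => s j) rfl
    (ψ := fun i u => (θ j : ℝ) / (j : ℕ) * (ζ i : ℝ) ^ (j : ℕ) * u ^ ((j : ℕ) - 1))
    (fun i => by fun_prop) (fun i t u hu => ?_) (a := pressureCoeff θ V j * (z₀ : ℝ) ^ (j : ℕ)) ?_
    (k := j) j.pos ?_ ?_ _ fun n lam => rfl
  · rw [hmul]
    exact tsum_exp_mul_siteWeight_le (mul_nonneg (ζ i).2 hu.1)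
      (summable_sitePressure_mul hV (hζc i) hu) j t
  · have hval : ∀ i, ∫ x, boltzmannFactor (V x) * ((θ j : ℝ) / (j : ℕ) * (ζ i : ℝ) ^ (j : ℕ) *
        boltzmannFactor (V x) ^ ((j : ℕ) - 1)) = pressureCoeff θ V j * (ζ i : ℝ) ^ (j : ℕ) := by
      intro i
      simp only [hmul, mul_pow, ← mul_assoc]
      rw [integral_const_mul, hV.integral_pow, pressureCoeff]
      ring
    simp only [hval]
    exact (((NNReal.continuous_coe.tendsto _).comp hζlim).pow _).const_mul _
  · exact ENNReal.div_ne_top (density_term_ne_top hV z₀ j) (ENNReal.ofReal_pos.2 hρ).ne'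
  · rw [ENNReal.toReal_div, toReal_density_term, ENNReal.toReal_ofReal hρ.le]

/-! ### The number of sites with a given number of particles -/

/-- A site with `k ≥ 1` particles lies in the support of the occupation numbers. -/
lemma natCast_N_eq {n k : ℕ} (hk : 1 ≤ k) (lam : SpatialPartition d n) :
    lam.N k = siteTotal (fun s => if partSize s = k then 1 else 0) lam := by
  classical
  have hset : {x | lam.H x = k} = ↑(lam.1.support.filter fun x => lam.H x = k) := by
    ext x
    rw [Finset.coe_filter, Set.mem_ofPred_eq, Set.mem_ofPred_eq, iff_and_self]
    intro hx
    refine Finsupp.mem_support_iff.2 fun h0 => ?_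
    have : lam.H x = 0 := by
      unfold SpatialPartition.H
      rw [h0]
      rfl
    omega
  rw [SpatialPartition.N, hset, Set.ncard_coe_finset, Finset.card_filter]
  rfl

lemma tsum_gibbsWeight_le {y : ℝ} (hy : 0 ≤ y)
    (hs : Summable fun j : ℕ+ => (θ j : ℝ) / (j : ℕ) * y ^ (j : ℕ)) :
    ∑' m : ℕ, gibbsWeight θ m * ENNReal.ofReal y ^ m ≤
      ENNReal.ofReal (Real.exp (sitePressure θ y)) := by
  have h := tsum_tilt_mul_siteWeight θ (ENNReal.ofReal y) fun _ => 1
  simp only [one_mul] at h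
  rw [← h]
  exact tsum_siteWeight_le hy hs

lemma one_le_tsum_gibbsWeight (y : ℝ≥0∞) : 1 ≤ ∑' m : ℕ, gibbsWeight θ m * y ^ m := by
  have h := tsum_tilt_mul_siteWeight θ y fun _ => 1
  simp only [one_mul] at h
  rw [← h, ← siteWeight_zero_right θ y]
  exact ENNReal.le_tsum 0

lemma gibbsWeight_ne_top (hV : AdmissiblePotential V) (hzc : 0 < criticalActivity θ V) (m : ℕ) :
    gibbsWeight θ m ≠ ∞ := by
  obtain ⟨z, hz0, hz⟩ := ENNReal.lt_iff_exists_nnreal_btwn.1 hzc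
  intro htop
  have h := (ENNReal.le_tsum m).trans (tsum_gibbsWeight_le z.2 (summable_sitePressure hV hz))
  rw [htop, ENNReal.top_mul (pow_ne_zero _ (by simpa using hz0.ne'))] at h
  exact ENNReal.ofReal_ne_top (top_le_iff.1 h)

/-- The generating function `∑_m h_m y^m` of one site, as a real number. -/
noncomputable def siteSeries (θ : ℕ → ℝ≥0) (y : ℝ) : ℝ :=
  ∑' m : ℕ, (gibbsWeight θ m).toReal * y ^ m

lemma summable_siteSeries {y : ℝ} (hy : 0 ≤ y) (hs : Summable fun j : ℕ+ => (θ j : ℝ) / (j : ℕ) * y ^ (j : ℕ)) :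
    Summable fun m : ℕ => (gibbsWeight θ m).toReal * y ^ m := by
  have h := ENNReal.summable_toReal
    (ne_top_of_le_ne_top ENNReal.ofReal_ne_top (tsum_gibbsWeight_le hy hs))
  refine h.congr fun m => ?_
  rw [ENNReal.toReal_mul, ENNReal.toReal_pow, ENNReal.toReal_ofReal hy]

lemma ofReal_siteSeries (hV : AdmissiblePotential V) (hzc : 0 < criticalActivity θ V) {y : ℝ}
    (hy : 0 ≤ y) (hs : Summable fun j : ℕ+ => (θ j : ℝ) / (j : ℕ) * y ^ (j : ℕ)) :
    ENNReal.ofReal (siteSeries θ y) = ∑' m : ℕ, gibbsWeight θ m * ENNReal.ofReal y ^ m := by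
  rw [siteSeries, ENNReal.ofReal_tsum_of_nonneg (fun m => by positivity)
    (summable_siteSeries hy hs)]
  refine tsum_congr fun m => ?_
  rw [ENNReal.ofReal_mul ENNReal.toReal_nonneg, ENNReal.ofReal_toReal (gibbsWeight_ne_top hV hzc m),
    ENNReal.ofReal_pow hy]

lemma one_le_siteSeries (hV : AdmissiblePotential V) (hzc : 0 < criticalActivity θ V) {y : ℝ}
    (hy : 0 ≤ y) (hs : Summable fun j : ℕ+ => (θ j : ℝ) / (j : ℕ) * y ^ (j : ℕ)) :
    1 ≤ siteSeries θ y := by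
  rw [← ENNReal.one_le_ofReal, ofReal_siteSeries hV hzc hy hs]
  exact one_le_tsum_gibbsWeight _

lemma siteSeries_le_exp (hV : AdmissiblePotential V) (hzc : 0 < criticalActivity θ V) {y : ℝ}
    (hy : 0 ≤ y) (hs : Summable fun j : ℕ+ => (θ j : ℝ) / (j : ℕ) * y ^ (j : ℕ)) :
    siteSeries θ y ≤ Real.exp (sitePressure θ y) := by
  rw [← ENNReal.ofReal_le_ofReal_iff (Real.exp_nonneg _), ofReal_siteSeries hV hzc hy hs]
  exact tsum_gibbsWeight_le hy hs

/-- The tilt of the partitions of `k` by `e^t` adds `(e^t - 1) h_k y^k` to the generating function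
`G = ∑_m h_m y^m`; the bound is `G (1 + p) ≤ e^P e^p`. -/
lemma tsum_exp_indicator_mul_siteWeight_le (hV : AdmissiblePotential V)
    (hzc : 0 < criticalActivity θ V) {y : ℝ} (hy : 0 ≤ y)
    (hs : Summable fun j : ℕ+ => (θ j : ℝ) / (j : ℕ) * y ^ (j : ℕ)) (k : ℕ) (t : ℝ) :
    ∑' s : ℕ+ →₀ ℕ, ENNReal.ofReal (Real.exp (t * ((if partSize s = k then 1 else 0 : ℕ) : ℝ))) *
        siteWeight θ (ENNReal.ofReal y) s ≤
      ENNReal.ofReal (Real.exp (sitePressure θ y +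
        (Real.exp t - 1) * ((gibbsWeight θ k).toReal * y ^ k / siteSeries θ y))) := by
  rw [tsum_tilt_mul_siteWeight θ (ENNReal.ofReal y)
    fun m => ENNReal.ofReal (Real.exp (t * ((if m = k then 1 else 0 : ℕ) : ℝ)))]
  have hG := summable_siteSeries hy hs
  have hG1 := one_le_siteSeries hV hzc hy hs
  have hsum : HasSum (fun m : ℕ => Real.exp (t * ((if m = k then 1 else 0 : ℕ) : ℝ)) *
      ((gibbsWeight θ m).toReal * y ^ m))
      (siteSeries θ y + (Real.exp t - 1) * ((gibbsWeight θ k).toReal * y ^ k)) := by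
    refine (hG.hasSum.add
      (hasSum_ite_eq k ((Real.exp t - 1) * ((gibbsWeight θ k).toReal * y ^ k)))).congr_fun ?_
    intro m
    by_cases h : m = k
    · subst h
      simp
      ring
    · simp [h]
  have heq : ∑' m : ℕ, ENNReal.ofReal (Real.exp (t * ((if m = k then 1 else 0 : ℕ) : ℝ))) *
      (gibbsWeight θ m * ENNReal.ofReal y ^ m) =
      ENNReal.ofReal (siteSeries θ y + (Real.exp t - 1) * ((gibbsWeight θ k).toReal * y ^ k)) := by
    rw [← hsum.tsum_eq, ENNReal.ofReal_tsum_of_nonneg (fun m => by positivity) hsum.summable]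
    refine tsum_congr fun m => ?_
    rw [ENNReal.ofReal_mul (Real.exp_nonneg _), ENNReal.ofReal_mul ENNReal.toReal_nonneg,
      ENNReal.ofReal_toReal (gibbsWeight_ne_top hV hzc m), ENNReal.ofReal_pow hy]
  rw [heq]
  refine ENNReal.ofReal_le_ofReal ?_
  have hG0 : 0 < siteSeries θ y := by linarith
  set p := (Real.exp t - 1) * ((gibbsWeight θ k).toReal * y ^ k / siteSeries θ y) with hp
  have h1 : siteSeries θ y + (Real.exp t - 1) * ((gibbsWeight θ k).toReal * y ^ k) =
      siteSeries θ y * (p + 1) := by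
    rw [hp]
    field_simp
    ring
  rw [h1, Real.exp_add]
  exact (mul_le_mul_of_nonneg_left (Real.add_one_le_exp p) hG0.le).trans
    (mul_le_mul_of_nonneg_right (siteSeries_le_exp hV hzc hy hs) (Real.exp_nonneg _))

lemma measurable_boltzmann (j : ℕ) : Measurable (boltzmann j) := by
  unfold boltzmann
  fun_prop

/-- The limiting density of the sites with `k` particles, weighted by `k`, at activity `z`, as a
function of the value `v` of the potential. -/
noncomputable def occupation (θ : ℕ → ℝ≥0) (k : ℕ) (z : ℝ≥0) (v : ℝ≥0∞) : ℝ≥0∞ :=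
  (k : ℝ≥0∞) * gibbsWeight θ k * (z : ℝ≥0∞) ^ k * boltzmann k v /
    ∑' m : ℕ, gibbsWeight θ m * (z : ℝ≥0∞) ^ m * boltzmann m v

lemma measurable_occupation (k : ℕ) (z : ℝ≥0) : Measurable (occupation θ k z) := by
  unfold occupation
  refine ((measurable_boltzmann k).const_mul _).div (Measurable.tsum fun m => ?_)
  exact (measurable_boltzmann m).const_mul _

lemma one_le_tsum_gibbsWeight_boltzmann (z v : ℝ≥0∞) :
    1 ≤ ∑' m : ℕ, gibbsWeight θ m * z ^ m * boltzmann m v := by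
  refine (one_le_tsum_gibbsWeight (θ := θ) (z * boltzmann 1 v)).trans
    (ENNReal.tsum_le_tsum fun m => ?_)
  rw [mul_pow, boltzmann_eq_pow m, mul_assoc]

lemma occupation_le (k : ℕ) (z : ℝ≥0) (v : ℝ≥0∞) :
    occupation θ k z v ≤ (k : ℝ≥0∞) * gibbsWeight θ k * (z : ℝ≥0∞) ^ k * boltzmann k v :=
  ENNReal.div_le_of_le_mul (le_mul_of_one_le_right zero_le (one_le_tsum_gibbsWeight_boltzmann _ _))

/-- Abel's theorem for the generating function of a site, whose value at `z₀` may be infinite. -/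
lemma tendsto_tsum_gibbsWeight (hV : AdmissiblePotential V) (hzc : 0 < criticalActivity θ V)
    {z₀ : ℝ≥0} {ζ : ℕ → ℝ≥0} (hζ : ∀ i, ζ i < z₀) (hζlim : Tendsto ζ atTop (𝓝 z₀)) (v : ℝ≥0∞) :
    Tendsto (fun i => ∑' m : ℕ, gibbsWeight θ m * (ζ i : ℝ≥0∞) ^ m * boltzmann m v) atTop
      (𝓝 (∑' m : ℕ, gibbsWeight θ m * (z₀ : ℝ≥0∞) ^ m * boltzmann m v)) := by
  have hζ' : Tendsto (fun i => (ζ i : ℝ≥0∞)) atTop (𝓝 (z₀ : ℝ≥0∞)) := ENNReal.tendsto_coe.2 hζlim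
  refine tendsto_order.2 ⟨fun c hc => ?_, fun c hc => Eventually.of_forall fun i =>
    lt_of_le_of_lt (ENNReal.tsum_le_tsum fun m => ?_) hc⟩
  · rw [ENNReal.tsum_eq_iSup_sum] at hc
    obtain ⟨s, hs⟩ := lt_iSup_iff.1 hc
    have hcont : Continuous fun z : ℝ≥0∞ => ∑ m ∈ s, gibbsWeight θ m * z ^ m * boltzmann m v := by
      refine continuous_finsetSum _ fun m _ => ?_
      refine (ENNReal.continuous_mul_const
        (ne_top_of_le_ne_top ENNReal.one_ne_top (boltzmann_le_one m v))).comp ?_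
      exact (ENNReal.continuous_const_mul (gibbsWeight_ne_top hV hzc m)).comp
        (ENNReal.continuous_pow m)
    filter_upwards [((hcont.tendsto _).comp hζ').eventually (lt_mem_nhds hs)] with i hi
    exact lt_of_lt_of_le hi (ENNReal.sum_le_tsum s)
  · have : (ζ i : ℝ≥0∞) ≤ z₀ := by exact_mod_cast (hζ i).le
    gcongr

lemma lintegral_occupation_bound_ne_top (hV : AdmissiblePotential V)
    (hzc : 0 < criticalActivity θ V) {k : ℕ} (hk : 1 ≤ k) (z : ℝ≥0) :
    ∫⁻ x, (k : ℝ≥0∞) * gibbsWeight θ k * (z : ℝ≥0∞) ^ k * boltzmann k (V x) ≠ ∞ := by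
  have hc : (k : ℝ≥0∞) * gibbsWeight θ k * (z : ℝ≥0∞) ^ k ≠ ∞ :=
    ENNReal.mul_ne_top (ENNReal.mul_ne_top (ENNReal.natCast_ne_top k)
      (gibbsWeight_ne_top hV hzc k)) (ENNReal.pow_ne_top ENNReal.coe_ne_top)
  rw [lintegral_const_mul' _ _ hc]
  exact ENNReal.mul_ne_top hc (hV.integral_ne_top k hk)

lemma tendsto_lintegral_occupation (hV : AdmissiblePotential V) (hzc : 0 < criticalActivity θ V)
    {z₀ : ℝ≥0} {ζ : ℕ → ℝ≥0} (hζ : ∀ i, ζ i < z₀) (hζlim : Tendsto ζ atTop (𝓝 z₀)) {k : ℕ}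
    (hk : 1 ≤ k) :
    Tendsto (fun i => ∫⁻ x, occupation θ k (ζ i) (V x)) atTop
      (𝓝 (∫⁻ x, occupation θ k z₀ (V x))) := by
  have hζ' : Tendsto (fun i => (ζ i : ℝ≥0∞)) atTop (𝓝 (z₀ : ℝ≥0∞)) := ENNReal.tendsto_coe.2 hζlim
  refine tendsto_lintegral_of_dominated_convergence' _
    (fun i => (measurable_occupation k _).comp_aemeasurable hV.aemeasurable)
    (fun i => ae_of_all _ fun x => (occupation_le k (ζ i) (V x)).trans ?_)
    (lintegral_occupation_bound_ne_top hV hzc hk z₀) (ae_of_all _ fun x => ?_)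
  · have : (ζ i : ℝ≥0∞) ≤ z₀ := by exact_mod_cast (hζ i).le
    gcongr
  · have hb : boltzmann k (V x) ≠ ∞ :=
      ne_top_of_le_ne_top ENNReal.one_ne_top (boltzmann_le_one k _)
    have hkg : (k : ℝ≥0∞) * gibbsWeight θ k ≠ ∞ :=
      ENNReal.mul_ne_top (ENNReal.natCast_ne_top k) (gibbsWeight_ne_top hV hzc k)
    refine ENNReal.Tendsto.div ?_ (Or.inr ?_) (tendsto_tsum_gibbsWeight hV hzc hζ hζlim (V x))
      (Or.inr ?_)
    · exact (((ENNReal.continuous_mul_const hb).comp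
        ((ENNReal.continuous_const_mul hkg).comp (ENNReal.continuous_pow k))).tendsto _).comp hζ'
    · exact (lt_of_lt_of_le one_pos (one_le_tsum_gibbsWeight_boltzmann _ _)).ne'
    · exact ENNReal.mul_ne_top (ENNReal.mul_ne_top hkg
        (ENNReal.pow_ne_top ENNReal.coe_ne_top)) hb

lemma occupation_eq_ofReal (hV : AdmissiblePotential V) (hzc : 0 < criticalActivity θ V)
    {z : ℝ≥0} (hz : (z : ℝ≥0∞) < criticalActivity θ V) (k : ℕ) (v : ℝ≥0∞) :
    occupation θ k z v = ENNReal.ofReal (k * ((gibbsWeight θ k).toReal *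
      (z * boltzmannFactor v) ^ k / siteSeries θ (z * boltzmannFactor v))) := by
  have hu := boltzmannFactor_mem_Icc v
  have hy : 0 ≤ (z : ℝ) * boltzmannFactor v := mul_nonneg z.2 hu.1
  have hs := summable_sitePressure_mul hV hz hu
  have hG1 := one_le_siteSeries hV hzc hy hs
  have hpow : ∀ m : ℕ, ENNReal.ofReal (z * boltzmannFactor v) ^ m =
      (z : ℝ≥0∞) ^ m * boltzmann m v := fun m => by
    rw [ENNReal.ofReal_mul z.coe_nonneg, ENNReal.ofReal_coe_nnreal, ofReal_boltzmannFactor, mul_pow,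
      ← boltzmann_eq_pow]
  rw [ENNReal.ofReal_mul (Nat.cast_nonneg _), ENNReal.ofReal_div_of_pos (by linarith),
    ofReal_siteSeries hV hzc hy hs, ENNReal.ofReal_mul ENNReal.toReal_nonneg,
    ENNReal.ofReal_toReal (gibbsWeight_ne_top hV hzc k), ENNReal.ofReal_pow hy,
    ENNReal.ofReal_natCast, occupation]
  simp only [hpow, ← mul_assoc, ← mul_div_assoc]

lemma tendstoInProbability_sites (hd : 1 ≤ d) (hρ : 0 < ρ) (hV : AdmissiblePotential V)
    (hzc : 0 < criticalActivity θ V) {j₁ : ℕ+} (hj₁ : θ j₁ ≠ 0) {z₀ : ℝ≥0}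
    (hz₀ : IsActivityAt θ V ρ z₀) {k : ℕ} (hk : 1 ≤ k) :
    TendstoInProbability θ V ρ (fun n lam => (k : ℝ) * (lam.N k : ℝ) / (n : ℝ))
      ((∫⁻ x, occupation θ k z₀ (V x)) / ENNReal.ofReal ρ) := by
  obtain ⟨ζ, -, hζ, hζlim⟩ := exists_seq_strictMono_tendsto' (hz₀.pos hzc hρ)
  have hζc : ∀ i, (ζ i : ℝ≥0∞) < criticalActivity θ V := fun i =>
    lt_of_lt_of_le (by exact_mod_cast (hζ i).2) (le_criticalActivity hz₀.density_ne_top)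
  have hk0 : (k : ℝ) ≠ 0 := by exact_mod_cast (by omega : k ≠ 0)
  set ψ : ℕ → ℝ → ℝ := fun i u => (gibbsWeight θ k).toReal * (ζ i : ℝ) ^ k * u ^ (k - 1) /
    siteSeries θ (ζ i * u) with hψ
  have hmul : ∀ i u, u * ψ i u =
      (gibbsWeight θ k).toReal * (ζ i * u) ^ k / siteSeries θ (ζ i * u) := fun i u => by
    simp only [hψ]
    rw [← mul_div_assoc, mul_left_comm, ← pow_succ', Nat.sub_add_cancel hk, mul_pow, mul_assoc]
  have hψc : ∀ i, ContinuousOn (ψ i) (Set.Icc 0 1) := by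
    intro i
    refine ContinuousOn.div (by fun_prop) ?_ fun u hu => ?_
    · refine continuousOn_tsum (fun m => by fun_prop)
        (summable_siteSeries (ζ i).2 (summable_sitePressure hV (hζc i))) fun m u hu => ?_
      have hu0 := hu.1
      rw [Real.norm_of_nonneg (by positivity), NNReal.val_eq_coe]
      gcongr
      exact mul_le_of_le_one_right (ζ i).coe_nonneg hu.2
    · have := one_le_siteSeries hV hzc (mul_nonneg (ζ i).2 hu.1)
        (summable_sitePressure_mul hV (hζc i) hu)
      exact (lt_of_lt_of_le one_pos this).ne'
  have hfin : ∀ z : ℝ≥0, ∫⁻ x, occupation θ k z (V x) ≠ ∞ := fun z =>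
    ne_top_of_le_ne_top (lintegral_occupation_bound_ne_top hV hzc hk z)
      (lintegral_mono fun x => occupation_le k z (V x))
  have hval : ∀ i, (∫⁻ x, occupation θ k (ζ i) (V x)).toReal / k =
      ∫ x, boltzmannFactor (V x) * ψ i (boltzmannFactor (V x)) := by
    intro i
    have hnn : ∀ x, 0 ≤ (k : ℝ) * (boltzmannFactor (V x) * ψ i (boltzmannFactor (V x))) := by
      intro x
      have hu := boltzmannFactor_mem_Icc (V x)
      have h1 := one_le_siteSeries hV hzc (mul_nonneg (ζ i).2 hu.1)
        (summable_sitePressure_mul hV (hζc i) hu)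
      rw [hmul]
      refine mul_nonneg (Nat.cast_nonneg _) (div_nonneg (mul_nonneg ENNReal.toReal_nonneg
        (pow_nonneg (mul_nonneg (ζ i).2 hu.1) _)) (zero_le_one.trans h1))
    have hmeas : AEStronglyMeasurable
        (fun x => (k : ℝ) * (boltzmannFactor (V x) * ψ i (boltzmannFactor (V x)))) volume := by
      have h1 : AEMeasurable (fun x => (occupation θ k (ζ i) (V x)).toReal) volume :=
        ((measurable_occupation k (ζ i)).comp_aemeasurable hV.aemeasurable).ennreal_toReal
      refine h1.aestronglyMeasurable.congr (ae_of_all _ fun x => ?_)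
      simp only
      rw [occupation_eq_ofReal hV hzc (hζc i), ← hmul, ENNReal.toReal_ofReal (hnn x)]
    have h := integral_eq_lintegral_of_nonneg_ae (ae_of_all volume hnn) hmeas
    rw [integral_const_mul] at h
    rw [div_eq_iff hk0, mul_comm, h]
    congr 1
    refine lintegral_congr fun x => ?_
    rw [hmul, occupation_eq_ofReal hV hzc (hζc i)]
  refine tendstoInProbability_of_site_bound hd hρ hV hzc hj₁ hz₀ (fun i => (hζ i).1)
    (fun i => (hζ i).2) hζlim (fun s => if partSize s = k then 1 else 0) ?_ hψc
    (fun i t u hu => ?_) (a := (∫⁻ x, occupation θ k z₀ (V x)).toReal / k) ?_ hk ?_ ?_ _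
    fun n lam => by rw [natCast_N_eq hk]
  · have : partSize 0 ≠ k := by
      rw [partSize, Finsupp.sum_zero_index]
      omega
    rw [if_neg this]
  · rw [hmul]
    exact tsum_exp_indicator_mul_siteWeight_le hV hzc (mul_nonneg (ζ i).2 hu.1)
      (summable_sitePressure_mul hV (hζc i) hu) k t
  · simp only [← hval]
    exact ((ENNReal.tendsto_toReal (hfin z₀)).comp (tendsto_lintegral_occupation hV hzc
      (fun i => (hζ i).2) hζlim hk)).div_const _
  · exact ENNReal.div_ne_top (hfin z₀) (ENNReal.ofReal_pos.2 hρ).ne'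
  · rw [ENNReal.toReal_div, ENNReal.toReal_ofReal hρ.le, mul_div_cancel₀ _ hk0]

end Limits

theorem theorem4p2 (d : ℕ) (hd : 1 ≤ d) (ρ : ℝ) (hρ : 0 < ρ)
    (θ : ℕ → ℝ≥0) (hθ : ∃ j : ℕ, 1 ≤ j ∧ θ j ≠ 0)
    (V : (Fin d → ℝ) → ℝ≥0∞) (hV : AdmissiblePotential V)
    (hzc : 0 < criticalActivity θ V) :
    -- the thermodynamic limit is not void, and the measures are eventually probability measures
    (thermodynamicLimit θ V ρ).NeBot ∧
    (∀ᶠ n in thermodynamicLimit θ V ρ,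
      IsProbabilityMeasure (canonicalMeasure θ V (lengthAt d ρ n) n)) ∧
    -- the activity `z₀(ρ)` is well defined, and the two limits hold
    (∃! z : ℝ≥0, IsActivityAt θ V ρ z) ∧
    ∀ z₀ : ℝ≥0, IsActivityAt θ V ρ z₀ →
      (∀ j : ℕ+,
        TendstoInProbability θ V ρ
          (fun n lam => ((j : ℕ) : ℝ) * (lam.R j : ℝ) / (n : ℝ))
          ((θ j : ℝ≥0∞) * (z₀ : ℝ≥0∞) ^ (j : ℕ) * boltzmannIntegral V j / ENNReal.ofReal ρ)) ∧
      (∀ k : ℕ,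
        TendstoInProbability θ V ρ
          (fun n lam => (k : ℝ) * (lam.N k : ℝ) / (n : ℝ))
          ((∫⁻ x, (k : ℝ≥0∞) * gibbsWeight θ k * (z₀ : ℝ≥0∞) ^ k * boltzmann k (V x) /
              (∑' m : ℕ, gibbsWeight θ m * (z₀ : ℝ≥0∞) ^ m * boltzmann m (V x))) /
            ENNReal.ofReal ρ)) := by
  obtain ⟨j₁, hj₁⟩ : ∃ j₁ : ℕ+, θ j₁ ≠ 0 := by
    obtain ⟨j, hj, hj'⟩ := hθ
    exact ⟨⟨j, hj⟩, hj'⟩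
  refine ⟨thermodynamicLimit_neBot hV.map_zero hj₁, ?_, existsUnique_isActivityAt hV hzc hρ hj₁,
    fun z₀ hz₀ => ⟨fun j => tendstoInProbability_parts hd hρ hV hzc hj₁ hz₀ j, fun k => ?_⟩⟩
  · refine eventually_inf_principal.2 ?_
    filter_upwards [eventually_partitionFunction_ne_top hd hρ hV hzc] with n hn h0
    exact isProbabilityMeasure_canonicalMeasure h0 hn
  · rcases Nat.eq_zero_or_pos k with rfl | hk
    · -- Both the observable and its limit vanish.
      refine ⟨by simp, fun ε hε => ?_⟩
      have hset : ∀ n : ℕ, {lam : SpatialPartition d n | ε < |((0 : ℕ) : ℝ) * (lam.N 0 : ℝ) / n -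
          ((∫⁻ x, ((0 : ℕ) : ℝ≥0∞) * gibbsWeight θ 0 * (z₀ : ℝ≥0∞) ^ 0 * boltzmann 0 (V x) /
            (∑' m : ℕ, gibbsWeight θ m * (z₀ : ℝ≥0∞) ^ m * boltzmann m (V x))) /
            ENNReal.ofReal ρ).toReal|} = ∅ := by
        intro n
        refine Set.eq_empty_of_forall_notMem fun lam hlam => hε.not_gt ?_
        simpa using hlam
      simp only [hset, measure_empty]
      exact tendsto_const_nhds
    · exact tendstoInProbability_sites hd hρ hV hzc hj₁ hz₀ hk
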